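/- Let $G$ be a finite group and let $A$ be a separable C*-algebra with $A\cong M_{|G|^\infty}\otimes A$, where $M_{|G|^\infty}$ is the UHF algebra $\bigotimes_{n\in\mathbb N} M_{|G|}(\mathbb C)$. Assume that $A$ is unital, or stable (that is, $A\cong\mathcal K\otimes A$, with $\mathcal K$ the compact operators on $\ell^2(\mathbb N)$), or has stable rank one (that is, the invertible elements of $\tilde A$ are dense in $\tilde A$). Here $\tilde A$ denotes the unitization of $A$ if $A$ is non-unital, and $\tilde A=A$ if $A$ is unital. For $*$-homomorphisms $\varphi,\psi:A\to A$ write $\varphi\approx_u\psi$ if there is a sequence of unitaries $u_n\in\tilde A$ with $\psi(a)=\lim_{n\to\infty}u_n\varphi(a)u_n^*$ for all $a\in A$. Put $A_\infty=\ell^\infty(\mathbb N,A)/c_0(\mathbb N,A)$, regard $A\subset A_\infty$ as the constant sequences, and let $$F_\infty(A)=(A_\infty\cap A')/\{x\in A_\infty : xa=ax=0\text{ for all }a\in A\},$$ which is a unital C*-algebra. An action $\gamma:G\to\operatorname{Aut}(A)$ induces an action $\gamma_\infty$ of $G$ on $F_\infty(A)$ by componentwise application. The action $\gamma$ has the Rokhlin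 property (is a Rokhlin action) if there is a unital $*$-homomorphism $C(G)\to F_\infty(A)$ that is equivariant for the shift action $(g\cdot f)(h)=f(g^{-1}h)$ of $G$ on $C(G)$ and for $\gamma_\infty$. Let $\{\beta_g\}_{g\in G}\subset\operatorname{Aut}(A)$ be a family of automorphisms such that $\beta_g\circ\beta_h\approx_u\beta_{gh}$ for all $g,h\in G$. Then there is a Rokhlin action $\gamma:G\curvearrowright A$ such that $\gamma_g\approx_u\beta_g$ for every $g\in G$. -/

import Mathlib

universe v

open Filter Topology
open scoped ENNReal TensorProduct

noncomputable section

namespace RokhlinLift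

/-! ### The UHF algebra of type `q^∞` and the compact operators -/

/-- The Hilbert space of square-summable families of complex numbers indexed by `X`. -/
abbrev EllTwo (X : Type) : Type := lp (fun _ : X => ℂ) 2

/-- Auxiliary: deleting the coordinates with `s k ≠ i` and relabelling does not increase the
`ℓ²`-norm. -/
theorem summable_update {q : ℕ} (k : ℕ) (i j : Fin q) (ξ : EllTwo (ℕ → Fin q)) :
    Summable (fun s : ℕ → Fin q =>
        ‖if s k = i then ξ (Function.update s k j) else 0‖ ^ (2 : ℝ)) ∧
      ∑' s : ℕ → Fin q, ‖if s k = i then ξ (Function.update s k j) else 0‖ ^ (2 : ℝ) ≤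
        ∑' s : ℕ → Fin q, ‖ξ s‖ ^ (2 : ℝ) := by
  have hsum : Summable (fun s : ℕ → Fin q => ‖ξ s‖ ^ (2 : ℝ)) := by
    have := (memℓp_gen_iff (p := 2) (by norm_num)).1 (lp.memℓp ξ)
    simpa using this
  let S : Set (ℕ → Fin q) := {s | s k = i}
  let f : S → (ℕ → Fin q) := fun s => Function.update s.1 k j
  have hf : Function.Injective f := by
    rintro ⟨s, hs⟩ ⟨t, ht⟩ h
    apply Subtype.ext
    funext m
    by_cases hm : m = k
    · subst hm
      exact hs.trans ht.symm
    · have := congrFun h m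
      simpa [f, Function.update_of_ne hm] using this
  have heq : (fun s : ℕ → Fin q =>
      ‖if s k = i then ξ (Function.update s k j) else 0‖ ^ (2 : ℝ)) =
      S.indicator (fun s => ‖ξ (Function.update s k j)‖ ^ (2 : ℝ)) := by
    funext s
    by_cases hs : s k = i
    · simp [S, hs]
    · simp [S, hs]
  have hsub : Summable ((fun s : ℕ → Fin q => ‖ξ s‖ ^ (2 : ℝ)) ∘ f) := hsum.comp_injective hf
  rw [heq]
  refine ⟨(summable_subtype_iff_indicator (s := S)).1 hsub, ?_⟩
  rw [← tsum_subtype S (fun s => ‖ξ (Function.update s k j)‖ ^ (2 : ℝ))]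
  exact hsub.tsum_le_tsum_of_inj f hf (fun _ _ => by positivity) (fun _ => le_rfl) hsum

/-- The matrix unit `e_{i,j}` of the `k`-th tensor factor of `M_q ⊗ M_q ⊗ ⋯`, acting on
`ℓ²((Fin q)^ℕ)`: it sends the basis vector `δ_t` to `δ_{t[k ↦ i]}` if `t k = j`, and to `0`
otherwise. -/
def siteMatrixUnit (q : ℕ) (k : ℕ) (i j : Fin q) :
    EllTwo (ℕ → Fin q) →L[ℂ] EllTwo (ℕ → Fin q) :=
  LinearMap.mkContinuous
    { toFun := fun ξ => ⟨fun s => if s k = i then ξ (Function.update s k j) else 0, by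
        refine (memℓp_gen_iff (p := 2) (by norm_num)).2 ?_
        simpa using (summable_update k i j ξ).1⟩
      map_add' := fun ξ η => by
        ext s
        change (if s k = i then ξ (Function.update s k j) + η (Function.update s k j) else 0) =
          (if s k = i then ξ (Function.update s k j) else 0) +
            (if s k = i then η (Function.update s k j) else 0)
        by_cases hs : s k = i <;> simp [hs]
      map_smul' := fun c ξ => by
        ext s
        by_cases hs : s k = i <;> simp [hs] }
    1 (fun ξ => by
      rw [one_mul]
      refine lp.norm_le_of_tsum_le (by norm_num) (norm_nonneg _) ?_
      rw [lp.norm_rpow_eq_tsum (by norm_num) ξ]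
      simpa using (summable_update k i j ξ).2)

/-- The UHF algebra `M_{q^∞}` (for `q ≥ 1`), the infinite tensor power of `M_q(ℂ)`: the unital
C*-algebra of operators on `ℓ²((Fin q)^ℕ)` generated by the matrix units of all tensor factors.
The first `n` factors generate a unital copy of `M_{q^n}`, and the union of these increasing
copies is dense. -/
def UHF (q : ℕ) : StarSubalgebra ℂ (EllTwo (ℕ → Fin q) →L[ℂ] EllTwo (ℕ → Fin q)) :=
  (StarAlgebra.adjoin ℂ
    {T | ∃ (k : ℕ) (i j : Fin q), T = siteMatrixUnit q k i j}).topologicalClosure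

instance (q : ℕ) :
    IsClosed (UHF q : Set (EllTwo (ℕ → Fin q) →L[ℂ] EllTwo (ℕ → Fin q))) :=
  StarSubalgebra.isClosed_topologicalClosure _

/-- The C*-algebra `𝒦` of compact operators on `ℓ²(ℕ)`, as the norm closure of the
*-algebra generated by the operators of rank one. -/
def Compacts : NonUnitalStarSubalgebra ℂ (EllTwo ℕ →L[ℂ] EllTwo ℕ) :=
  (NonUnitalStarAlgebra.adjoin ℂ
    {T | ∃ ξ η : EllTwo ℕ, T = InnerProductSpace.rankOne ℂ ξ η}).topologicalClosure

instance : IsClosed (Compacts : Set (EllTwo ℕ →L[ℂ] EllTwo ℕ)) :=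
  NonUnitalStarSubalgebra.isClosed_topologicalClosure _

/-! ### Tensor products, stability, stable rank one -/

/-- `B`, together with `j : C ⊙ A → B`, is a C*-tensor product of `C` and `A`: a completion of the
algebraic tensor product `C ⊙ A` in a C*-norm (the norm `x ↦ ‖j x‖`).  It is used only for
nuclear `C` (UHF algebras and the compact operators).  Then `C ⊙ A` has exactly one C*-norm, and
so `B` is the C*-algebra `C ⊗ A`. -/
def IsCStarTensorProduct {C A B : Type*} [NonUnitalCStarAlgebra C] [NonUnitalCStarAlgebra A]
    [NonUnitalCStarAlgebra B] (j : C ⊗[ℂ] A →⋆ₙₐ[ℂ] B) : Prop :=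
  Function.Injective j ∧ DenseRange j

/-- `A ≅ C ⊗ A`, for nuclear `C`. -/
def TensorAbsorbs (C : Type*) (A : Type v) [NonUnitalCStarAlgebra C] [NonUnitalCStarAlgebra A] :
    Prop :=
  ∃ (B : Type v) (_ : NonUnitalCStarAlgebra B) (j : C ⊗[ℂ] A →⋆ₙₐ[ℂ] B),
    IsCStarTensorProduct j ∧ Nonempty (A ≃⋆ₐ[ℂ] B)

/-- `A` has a unit. -/
def HasUnit (A : Type*) [NonUnitalCStarAlgebra A] : Prop :=
  ∃ e : A, ∀ a, e * a = a ∧ a * e = a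

/-- `A` is stable: `A ≅ 𝒦 ⊗ A`. -/
def IsStable (A : Type*) [NonUnitalCStarAlgebra A] : Prop :=
  TensorAbsorbs Compacts A

/-- `A` has stable rank one: the invertible elements of the unitization are dense in it.  (If `A`
already has a unit, then `Unitization ℂ A ≅ A × ℂ`, so that this says that the invertible
elements of `A` are dense in `A`.) -/
def HasStableRankOne (A : Type*) [NonUnitalCStarAlgebra A] : Prop :=
  Dense {x : Unitization ℂ A | IsUnit x}

/-! ### Approximate unitary equivalence -/

/-- Approximate unitary equivalence: `ψ a = lim uₙ (φ a) uₙ*` for all `a`, for a sequence of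
unitaries `uₙ` in the unitization of `B`.  (If `B` already has a unit, then
`Unitization ℂ B ≅ B × ℂ`, and conjugating elements of `B` by unitaries of the unitization is
the same as conjugating them by unitaries of `B`.) -/
def ApproxUnitarilyEquiv {A B : Type*} [NonUnitalCStarAlgebra A] [NonUnitalCStarAlgebra B]
    (φ ψ : A →⋆ₙₐ[ℂ] B) : Prop :=
  ∃ u : ℕ → unitary (Unitization ℂ B), ∀ a : A,
    Tendsto (fun n => (u n : Unitization ℂ B) * (φ a : Unitization ℂ B) *
      star (u n : Unitization ℂ B)) atTop (𝓝 (ψ a : Unitization ℂ B))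

/-! ### Quotients of *-algebras -/

section StarQuotient

variable {R S : Type*} [NonUnitalRing R] [StarRing R] [Module ℂ R]
  [NonUnitalRing S] [StarRing S] [Module ℂ S]

variable (R) in
/-- A two-sided *-ideal of a (non-unital) *-algebra over `ℂ`. -/
structure StarIdeal where
  /-- The underlying set. -/
  carrier : Set R
  zero_mem : 0 ∈ carrier
  add_mem : ∀ {x y : R}, x ∈ carrier → y ∈ carrier → x + y ∈ carrier
  smul_mem : ∀ (c : ℂ) {x : R}, x ∈ carrier → c • x ∈ carrier
  mul_mem_left : ∀ (x : R) {y : R}, y ∈ carrier → x * y ∈ carrier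
  mul_mem_right : ∀ {x : R} (y : R), x ∈ carrier → x * y ∈ carrier
  star_mem : ∀ {x : R}, x ∈ carrier → star x ∈ carrier

namespace StarIdeal

/-- The underlying ring ideal. -/
def ideal (I : StarIdeal R) : TwoSidedIdeal R :=
  TwoSidedIdeal.mk' I.carrier I.zero_mem I.add_mem
    (fun {x} hx => by simpa using I.smul_mem (-1) hx) (I.mul_mem_left _) (I.mul_mem_right _)

theorem mem_ideal {I : StarIdeal R} {x : R} : x ∈ I.ideal ↔ x ∈ I.carrier :=
  TwoSidedIdeal.mem_mk' _ _ _ _ _ _ _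

/-- The quotient *-algebra `R / I`. -/
def Quotient (I : StarIdeal R) : Type _ := I.ideal.ringCon.Quotient

variable (I : StarIdeal R)

instance : NonUnitalRing I.Quotient := inferInstanceAs (NonUnitalRing I.ideal.ringCon.Quotient)

/-- The quotient map as a function. -/
def mkFun (x : R) : I.Quotient := RingCon.toQuotient x

theorem mkFun_surjective : Function.Surjective I.mkFun := Quotient.mk''_surjective

theorem mkFun_eq_iff {x y : R} : I.mkFun x = I.mkFun y ↔ x - y ∈ I.carrier :=
  (RingCon.eq _).trans ((TwoSidedIdeal.rel_iff _ _ _).trans mem_ideal)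

/-- The map of quotients induced by a map that respects congruence modulo the ideals. -/
def mapFun (I : StarIdeal R) (J : StarIdeal S) (f : R → S)
    (hf : ∀ x y, x - y ∈ I.carrier → f x - f y ∈ J.carrier) : I.Quotient → J.Quotient :=
  Quotient.map' f fun x y h => by
    have h' : x - y ∈ I.carrier := mem_ideal.1 ((TwoSidedIdeal.rel_iff _ _ _).1 h)
    exact (TwoSidedIdeal.rel_iff _ _ _).2 (mem_ideal.2 (hf x y h'))

theorem mapFun_mkFun (I : StarIdeal R) (J : StarIdeal S) (f : R → S)
    (hf : ∀ x y, x - y ∈ I.carrier → f x - f y ∈ J.carrier) (x : R) :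
    mapFun I J f hf (I.mkFun x) = J.mkFun (f x) := rfl

instance : SMul ℂ I.Quotient where
  smul c := mapFun I I (c • ·) fun x y h => by
    simpa [smul_sub] using I.smul_mem c h

instance : Star I.Quotient where
  star := mapFun I I star fun x y h => by
    simpa using I.star_mem h

theorem mkFun_add (x y : R) : I.mkFun (x + y) = I.mkFun x + I.mkFun y := rfl
theorem mkFun_mul (x y : R) : I.mkFun (x * y) = I.mkFun x * I.mkFun y := rfl
theorem mkFun_zero : I.mkFun 0 = 0 := rfl
theorem mkFun_smul (c : ℂ) (x : R) : I.mkFun (c • x) = c • I.mkFun x := rfl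
theorem mkFun_star (x : R) : I.mkFun (star x) = star (I.mkFun x) := rfl

instance : Module ℂ I.Quotient :=
  Function.Surjective.module ℂ
    (⟨⟨I.mkFun, I.mkFun_zero⟩, I.mkFun_add⟩ : R →+ I.Quotient) I.mkFun_surjective I.mkFun_smul

instance : StarRing I.Quotient where
  star_involutive := by
    rw [Function.Involutive, I.mkFun_surjective.forall]
    intro x
    rw [← mkFun_star, ← mkFun_star, star_star]
  star_mul := by
    simp only [I.mkFun_surjective.forall]
    intro x y
    simp only [← mkFun_star, ← mkFun_mul, star_mul]
  star_add := by
    simp only [I.mkFun_surjective.forall]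
    intro x y
    simp only [← mkFun_star, ← mkFun_add, star_add]

instance [IsScalarTower ℂ R R] : IsScalarTower ℂ I.Quotient I.Quotient where
  smul_assoc c := by
    simp only [I.mkFun_surjective.forall, smul_eq_mul]
    intro x y
    simp only [← mkFun_smul, ← mkFun_mul, smul_mul_assoc]

instance [SMulCommClass ℂ R R] : SMulCommClass ℂ I.Quotient I.Quotient where
  smul_comm c := by
    simp only [I.mkFun_surjective.forall, smul_eq_mul]
    intro x y
    simp only [← mkFun_smul, ← mkFun_mul, mul_smul_comm]

instance [StarModule ℂ R] : StarModule ℂ I.Quotient where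
  star_smul c := by
    simp only [I.mkFun_surjective.forall]
    intro x
    simp only [← mkFun_smul, ← mkFun_star, star_smul]

/-- The quotient map `R → R / I`. -/
def proj : R →⋆ₙₐ[ℂ] I.Quotient where
  toFun := I.mkFun
  map_smul' := I.mkFun_smul
  map_zero' := I.mkFun_zero
  map_add' := I.mkFun_add
  map_mul' := I.mkFun_mul
  map_star' := I.mkFun_star

theorem proj_surjective : Function.Surjective I.proj := I.mkFun_surjective

theorem proj_eq_iff {x y : R} : I.proj x = I.proj y ↔ x - y ∈ I.carrier := I.mkFun_eq_iff

/-- The *-homomorphism of quotients induced by a *-homomorphism that respects the ideals. -/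
def map (I : StarIdeal R) (J : StarIdeal S) (f : R →⋆ₙₐ[ℂ] S)
    (hf : ∀ x ∈ I.carrier, f x ∈ J.carrier) : I.Quotient →⋆ₙₐ[ℂ] J.Quotient where
  toFun := mapFun I J f fun x y h => by simpa using hf _ h
  map_smul' c := by
    rw [I.mkFun_surjective.forall]
    intro x
    simp only [← mkFun_smul, mapFun_mkFun, map_smul, MonoidHom.id_apply]
  map_zero' := by rw [← mkFun_zero, mapFun_mkFun, map_zero, mkFun_zero]
  map_add' := by
    simp only [I.mkFun_surjective.forall]
    intro x y
    simp only [← mkFun_add, mapFun_mkFun, map_add]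
  map_mul' := by
    simp only [I.mkFun_surjective.forall]
    intro x y
    simp only [← mkFun_mul, mapFun_mkFun, map_mul]
  map_star' := by
    rw [I.mkFun_surjective.forall]
    intro x
    simp only [← mkFun_star, mapFun_mkFun, map_star]

theorem map_proj (I : StarIdeal R) (J : StarIdeal S) (f : R →⋆ₙₐ[ℂ] S)
    (hf : ∀ x ∈ I.carrier, f x ∈ J.carrier) (x : R) : map I J f hf (I.proj x) = J.proj (f x) := rfl

end StarIdeal

end StarQuotient

/-! ### The central sequence algebra and the Rokhlin property -/

section CentralSequences

/-- The C*-algebra `ℓ^∞(ℕ, A)` of bounded sequences in `A`. -/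
abbrev BoundedSeq (A : Type*) [NonUnitalCStarAlgebra A] : Type _ :=
  BoundedContinuousFunction ℕ A

variable {A : Type*} [NonUnitalCStarAlgebra A]

variable (A) in
/-- The ideal `c₀(ℕ, A)` of null sequences in `ℓ^∞(ℕ, A)`. -/
def nullSeq : StarIdeal (BoundedSeq A) where
  carrier := {x | Tendsto (fun n => x n) atTop (𝓝 0)}
  zero_mem := by simp
  add_mem {x y} hx hy := by simpa using Tendsto.add hx hy
  smul_mem c {x} hx := by simpa using Tendsto.const_smul hx c
  mul_mem_left x {y} hy := by
    have h : Tendsto (fun n => ‖x‖ * ‖y n‖) atTop (𝓝 0) := by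
      simpa using (Tendsto.norm hy).const_mul ‖x‖
    refine squeeze_zero_norm (fun n => ?_) h
    exact (norm_mul_le _ _).trans
      (mul_le_mul_of_nonneg_right (x.norm_coe_le_norm n) (norm_nonneg _))
  mul_mem_right {x} y hx := by
    have h : Tendsto (fun n => ‖x n‖ * ‖y‖) atTop (𝓝 0) := by
      simpa using (Tendsto.norm hx).mul_const ‖y‖
    refine squeeze_zero_norm (fun n => ?_) h
    exact (norm_mul_le _ _).trans
      (mul_le_mul_of_nonneg_left (y.norm_coe_le_norm n) (norm_nonneg _))
  star_mem {x} hx := by simpa using Tendsto.star hx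

variable (A) in
/-- The sequence algebra `A_∞ = ℓ^∞(ℕ, A) / c₀(ℕ, A)`. -/
abbrev SeqAlg : Type _ := (nullSeq A).Quotient

variable (A) in
/-- The constant sequences, as a *-homomorphism `A → ℓ^∞(ℕ, A)`. -/
def constSeq : A →⋆ₙₐ[ℂ] BoundedSeq A where
  toFun a := BoundedContinuousFunction.const ℕ a
  map_smul' _ _ := rfl
  map_zero' := rfl
  map_add' _ _ := rfl
  map_mul' _ _ := rfl
  map_star' _ := rfl

variable (A) in
/-- The canonical embedding `A → A_∞`. -/
def toSeqAlg : A →⋆ₙₐ[ℂ] SeqAlg A := (nullSeq A).proj.comp (constSeq A)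

/-- Componentwise application of an automorphism of `A` to bounded sequences. -/
def seqMap (α : A ≃⋆ₐ[ℂ] A) : BoundedSeq A →⋆ₙₐ[ℂ] BoundedSeq A where
  toFun x := BoundedContinuousFunction.ofNormedAddCommGroupDiscrete (fun n => α (x n)) ‖x‖
    fun n => (NonUnitalStarAlgHom.norm_apply_le α (x n)).trans (x.norm_coe_le_norm n)
  map_smul' c x := by ext n; simp
  map_zero' := by ext n; simp
  map_add' x y := by ext n; simp
  map_mul' x y := by ext n; simp
  map_star' x := by ext n; simp [map_star]

theorem seqMap_apply (α : A ≃⋆ₐ[ℂ] A) (x : BoundedSeq A) (n : ℕ) : seqMap α x n = α (x n) := rfl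

/-- The *-endomorphism of `A_∞` induced by componentwise application of `α`. -/
def seqAlgMap (α : A ≃⋆ₐ[ℂ] A) : SeqAlg A →⋆ₙₐ[ℂ] SeqAlg A :=
  StarIdeal.map _ _ (seqMap α) fun x hx =>
    squeeze_zero_norm (fun n => NonUnitalStarAlgHom.norm_apply_le α (x n))
      (by simpa using Tendsto.norm hx)

theorem seqAlgMap_toSeqAlg (α : A ≃⋆ₐ[ℂ] A) (a : A) :
    seqAlgMap α (toSeqAlg A a) = toSeqAlg A (α a) := rfl

variable (A) in
/-- The relative commutant `A_∞ ∩ A'`. -/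
def centralSeq : NonUnitalStarSubalgebra ℂ (SeqAlg A) :=
  NonUnitalStarSubalgebra.centralizer ℂ (Set.range (toSeqAlg A))

theorem mem_centralSeq {x : SeqAlg A} :
    x ∈ centralSeq A ↔ ∀ a : A, toSeqAlg A a * x = x * toSeqAlg A a := by
  rw [centralSeq, NonUnitalStarSubalgebra.mem_centralizer_iff]
  constructor
  · exact fun h a => (h _ ⟨a, rfl⟩).1
  · rintro h _ ⟨a, rfl⟩
    refine ⟨h a, ?_⟩
    rw [← map_star]
    exact h _

variable (A) in
/-- The annihilator of `A` in `A_∞`, as an ideal of `A_∞ ∩ A'`. -/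
def annSeq : StarIdeal (centralSeq A) where
  carrier := {x | ∀ a : A, (x : SeqAlg A) * toSeqAlg A a = 0 ∧ toSeqAlg A a * (x : SeqAlg A) = 0}
  zero_mem := by simp
  add_mem {x y} hx hy a := by simp [add_mul, mul_add, hx a, hy a]
  smul_mem c {x} hx a := by simp [smul_mul_assoc, mul_smul_comm, hx a]
  mul_mem_left x {y} hy a := by
    refine ⟨by simp [mul_assoc, hy a], ?_⟩
    rw [NonUnitalStarSubalgebra.coe_mul, ← mul_assoc, mem_centralSeq.1 x.2 a, mul_assoc, (hy a).2,
      mul_zero]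
  mul_mem_right {x} y hx a := by
    refine ⟨?_, by simp [← mul_assoc, hx a]⟩
    rw [NonUnitalStarSubalgebra.coe_mul, mul_assoc, ← mem_centralSeq.1 y.2 a, ← mul_assoc,
      (hx a).1, zero_mul]
  star_mem {x} hx a := by
    constructor
    · have := congrArg star (hx (star a)).2
      simpa [map_star] using this
    · have := congrArg star (hx (star a)).1
      simpa [map_star] using this

variable (A) in
/-- The central sequence algebra `F_∞(A) = (A_∞ ∩ A') / ann(A, A_∞)`. -/
abbrev CentralSeqAlg : Type _ := (annSeq A).Quotient

/-- The *-endomorphism of `A_∞ ∩ A'` induced by componentwise application of `α`. -/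
def centralSeqMap (α : A ≃⋆ₐ[ℂ] A) : centralSeq A →⋆ₙₐ[ℂ] centralSeq A :=
  NonUnitalStarAlgHom.codRestrict
    ((seqAlgMap α).comp (NonUnitalStarSubalgebraClass.subtype (centralSeq A))) (centralSeq A)
    fun x => mem_centralSeq.2 fun a => by
      have h := congrArg (seqAlgMap α) (mem_centralSeq.1 x.2 (α.symm a))
      simpa [map_mul, seqAlgMap_toSeqAlg] using h

/-- The map `α_∞` on `F_∞(A)` induced by componentwise application of `α`. -/
def centralSeqAlgMap (α : A ≃⋆ₐ[ℂ] A) : CentralSeqAlg A →⋆ₙₐ[ℂ] CentralSeqAlg A :=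
  StarIdeal.map _ _ (centralSeqMap α) fun x hx a => by
    have h := hx (α.symm a)
    have h1 := congrArg (seqAlgMap α) h.1
    have h2 := congrArg (seqAlgMap α) h.2
    rw [map_mul, seqAlgMap_toSeqAlg, map_zero, StarAlgEquiv.apply_symm_apply] at h1 h2
    exact ⟨h1, h2⟩

/-- The Rokhlin property of an action `α` of a finite group `G` on a separable C*-algebra `A`:
there is a unital *-homomorphism from `C(G)` to the central sequence algebra `F_∞(A)` that is
equivariant for the shift action `(g • f)(h) = f(g⁻¹h)` of `G` on `C(G)` and for `α_∞`.
(`F_∞(A)` is unital, as `A` is separable; the first condition says that `φ 1` is its unit.) -/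
def HasRokhlinProperty {G : Type*} [Group G] (α : G →* (A ≃⋆ₐ[ℂ] A)) : Prop :=
  ∃ φ : (G → ℂ) →⋆ₙₐ[ℂ] CentralSeqAlg A,
    (∀ x : CentralSeqAlg A, φ 1 * x = x ∧ x * φ 1 = x) ∧
    ∀ (g : G) (f : G → ℂ), φ (fun h => f (g⁻¹ * h)) = centralSeqAlgMap (α g) (φ f)

end CentralSequences

end RokhlinLift

end

open RokhlinLift

/-! The action γ is a pointwise limit of perturbations of β by inner automorphisms. What makes the
perturbations possible is a net of approximately central matrix units e_{ij} in A, indexed by G × G,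
which UHF absorption provides (`exists_centralMatrixUnits`).

Given such units, suppose that unitaries W_g can be found for which Ad(W_g)β_g carries e_{mm} y to
e_{kk} β_k⁻¹β_m(y), where k = m g⁻¹. Then products telescope: after β_m is applied in the m-th
block, the corrected family merely permutes the blocks by right translation, so it is
multiplicative, and the e_{mm} form a Rokhlin tower for it (`twist_identities`).

Such a W_g is a product of two unitaries. One carries β_g(e_{mm}) to e_{kk}: the symmetry Σ f_{ij}
e_{ji} exchanges two commuting systems of matrix units, and a third system commuting with both is
used as an intermediary. The other is diagonal, and in the block e_{kk} it is a unitary that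
conjugates β_g approximately into β_k⁻¹β_{kg}. Both constructions become exact in a ring of bounded
functions modulo null functions along an iterated limit (`exists_rokhlin_net`).

The correction displaces y by at most |G|δ + ε, where δ bounds the defects of β_gβ_h = β_{gh} at y
(`exists_rokhlin_step`). After one correction the defects are small on a finite set, so the later
corrections move its elements by summable amounts. The corrected families therefore converge to an
action (`exists_limit_action`) for which the towers remain approximately equivariant
(`hasRokhlinProperty_of_seq`). -/

noncomputable section

namespace RokhlinLift

/-! ### Bounded functions modulo null functions, and lifting unitaries from the quotient. -/

section SequenceQuotient

/-- The ring of bounded functions from `I` to a normed ring. -/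
def BddFun (I E : Type*) [CStarAlgebra E] : Subring (I → E) where
  carrier := {f | ∃ C : ℝ, ∀ i, ‖f i‖ ≤ C}
  mul_mem' := by
    rintro f g ⟨C, hC⟩ ⟨D, hD⟩
    refine ⟨C * D, fun i => (norm_mul_le _ _).trans ?_⟩
    exact mul_le_mul (hC i) (hD i) (norm_nonneg _) ((norm_nonneg _).trans (hC i))
  one_mem' := ⟨‖(1 : E)‖, fun _ => le_rfl⟩
  add_mem' := by
    rintro f g ⟨C, hC⟩ ⟨D, hD⟩
    exact ⟨C + D, fun i => (norm_add_le _ _).trans (add_le_add (hC i) (hD i))⟩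
  zero_mem' := ⟨0, fun _ => by simp⟩
  neg_mem' := by
    rintro f ⟨C, hC⟩
    exact ⟨C, fun i => by simpa using hC i⟩

/-- The two-sided ideal of bounded functions tending to zero along a filter. -/
def nullIdeal {I : Type*} (L : Filter I) (E : Type*) [CStarAlgebra E] : Ideal (BddFun I E) where
  carrier := {f | Tendsto f.1 L (𝓝 0)}
  add_mem' := fun {f g} hf hg => by
    have h := Tendsto.add hf hg
    rwa [add_zero] at h
  zero_mem' := tendsto_const_nhds
  smul_mem' := by
    rintro ⟨f, C, hC⟩ g (hg : Tendsto g.1 L (𝓝 0))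
    have h : Tendsto (fun i => C * ‖g.1 i‖) L (𝓝 0) := by
      simpa using (Tendsto.norm hg).const_mul C
    exact squeeze_zero_norm (fun i => (norm_mul_le _ _).trans
      (mul_le_mul_of_nonneg_right (hC i) (norm_nonneg _))) h

instance {I : Type*} (L : Filter I) (E : Type*) [CStarAlgebra E] : (nullIdeal L E).IsTwoSided where
  mul_mem_of_left := by
    rintro f ⟨g, C, hC⟩ (hf : Tendsto f.1 L (𝓝 0))
    have h : Tendsto (fun i => ‖f.1 i‖ * C) L (𝓝 0) := by
      simpa using (Tendsto.norm hf).mul_const C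
    exact squeeze_zero_norm (fun i => (norm_mul_le _ _).trans
      (mul_le_mul_of_nonneg_left (hC i) (norm_nonneg _))) h

/-- Bounded functions modulo functions tending to zero along a filter. -/
def SeqQuot {I : Type*} (L : Filter I) (E : Type*) [CStarAlgebra E] : Type _ :=
  BddFun I E ⧸ nullIdeal L E

instance {I : Type*} (L : Filter I) (E : Type*) [CStarAlgebra E] : Ring (SeqQuot L E) :=
  Ideal.Quotient.ring (nullIdeal L E)

variable {I E : Type*}

/-- The class of a bounded function. -/
def cls [CStarAlgebra E] (L : Filter I) : BddFun I E →+* SeqQuot L E :=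
  Ideal.Quotient.mk (nullIdeal L E)

theorem cls_eq_iff [CStarAlgebra E] {L : Filter I} {x y : BddFun I E} :
    cls L x = cls L y ↔ Tendsto (fun i => x.1 i - y.1 i) L (𝓝 0) :=
  Ideal.Quotient.eq

theorem cls_eq_zero_iff [CStarAlgebra E] {L : Filter I} {x : BddFun I E} :
    cls L x = 0 ↔ Tendsto x.1 L (𝓝 0) :=
  Ideal.Quotient.eq_zero_iff_mem

variable [CStarAlgebra E]

/-- The pointwise adjoint of a bounded function. -/
def bstar (x : BddFun I E) : BddFun I E :=
  ⟨fun i => star (x.1 i), x.2.imp fun _ h i => by simpa using h i⟩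

theorem cls_bstar_congr {L : Filter I} {x y : BddFun I E} (h : cls L x = cls L y) :
    cls L (bstar x) = cls L (bstar y) := by
  rw [cls_eq_iff] at h ⊢
  simpa [bstar] using h.star

theorem bstar_mul (x y : BddFun I E) : bstar (x * y) = bstar y * bstar x :=
  Subtype.ext <| funext fun _ => star_mul _ _

theorem bstar_bstar (x : BddFun I E) : bstar (bstar x) = x :=
  Subtype.ext <| funext fun _ => star_star _

/-- A family of unitaries as a bounded function. -/
def unitaryFun (u : I → unitary E) : BddFun I E :=
  ⟨fun i => u i, 1, fun i => by
    rcases subsingleton_or_nontrivial E with h | h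
    · simp [Subsingleton.elim (u i : E) 0]
    · simp⟩

theorem unitaryFun_mul_bstar (u : I → unitary E) : unitaryFun u * bstar (unitaryFun u) = 1 :=
  Subtype.ext <| funext fun i => Unitary.mul_star_self_of_mem (u i).2

theorem bstar_mul_unitaryFun (u : I → unitary E) : bstar (unitaryFun u) * unitaryFun u = 1 :=
  Subtype.ext <| funext fun i => Unitary.star_mul_self_of_mem (u i).2

open NormedSpace in
/-- The partial-sum defect of the exponential series at `π i h`, relative to its value on an
idempotent. -/
def expDefect (h : E) (m : ℕ) : E :=
  ((m.factorial⁻¹ : ℂ) * (Real.pi * Complex.I) ^ m) • (if m = 0 then 0 else h ^ m - h)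

-- The expansion of e^{πi} h = -h is subtracted from the series of exp(πih). For m ≥ 1 the terms
-- become multiples of h^m - h, which vanish on idempotents; the constant terms differ by 1 - h,
-- which is removed separately.
open NormedSpace in
theorem hasSum_expDefect (h : E) :
    HasSum (expDefect h) (exp ((Real.pi * Complex.I : ℂ) • h) - 1 + (2 : ℂ) • h) := by
  have h1 := exp_series_hasSum_exp' (𝕂 := ℂ) ((Real.pi * Complex.I : ℂ) • h)
  have h2 := (exp_series_hasSum_exp' (𝕂 := ℂ) (Real.pi * Complex.I : ℂ)).smul_const h
  rw [← Complex.exp_eq_exp_ℂ, Complex.exp_pi_mul_I] at h2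
  have h3 : HasSum (fun m : ℕ => if m = 0 then (1 - h) else 0) (1 - h) := hasSum_ite_eq 0 _
  have hfun : expDefect h = fun m : ℕ =>
      ((m.factorial⁻¹ : ℂ) • ((Real.pi * Complex.I : ℂ) • h) ^ m -
        ((m.factorial⁻¹ : ℂ) • (Real.pi * Complex.I : ℂ) ^ m) • h) -
        if m = 0 then (1 - h) else 0 := by
    ext m
    by_cases hm : m = 0
    · simp [expDefect, hm]
    · simp [expDefect, hm, smul_pow, smul_sub, smul_smul]
  rw [hfun]
  have hsum : NormedSpace.exp ((Real.pi * Complex.I : ℂ) • h) - 1 + (2 : ℂ) • h =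
      NormedSpace.exp ((Real.pi * Complex.I : ℂ) • h) - (-1 : ℂ) • h - (1 - h) := by
    simp only [neg_smul, one_smul, two_smul]
    abel
  rw [hsum]
  exact (h1.sub h2).sub h3

theorem norm_expDefect_le {h : E} {C : ℝ} (hC : 1 ≤ C) (hh : ‖h‖ ≤ C) (m : ℕ) :
    ‖expDefect h m‖ ≤ 2 * C * ((m.factorial⁻¹ : ℝ) * (Real.pi * C) ^ m) := by
  have hfac : ‖((m.factorial⁻¹ : ℂ) * (Real.pi * Complex.I) ^ m)‖ =
      (m.factorial⁻¹ : ℝ) * Real.pi ^ m := by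
    simp [abs_of_pos Real.pi_pos]
  rw [expDefect, norm_smul, hfac, mul_pow]
  have hCm : 1 ≤ C ^ m := one_le_pow₀ hC
  have : ‖(if m = 0 then 0 else h ^ m - h : E)‖ ≤ 2 * C * C ^ m := by
    split_ifs with hm
    · simp; positivity
    · have h1 : ‖h ^ m‖ ≤ C ^ m :=
        (norm_pow_le' h (Nat.pos_of_ne_zero hm)).trans (pow_le_pow_left₀ (norm_nonneg _) hh m)
      have h2 := norm_sub_le (h ^ m) h
      nlinarith
  calc _ ≤ (m.factorial⁻¹ : ℝ) * Real.pi ^ m * (2 * C * C ^ m) := by gcongr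
    _ = _ := by ring

theorem summable_expDefect_bound (C : ℝ) :
    Summable fun m : ℕ => 2 * C * ((m.factorial⁻¹ : ℝ) * (Real.pi * C) ^ m) := by
  refine Summable.mul_left _ ?_
  have := Real.summable_pow_div_factorial (Real.pi * C)
  simpa [div_eq_inv_mul] using this

theorem isUnitary_exp_pi_mul {h : E} (hh : IsSelfAdjoint h) :
    NormedSpace.exp ((Real.pi * Complex.I : ℂ) • h) ∈ unitary E := by
  have hs : IsSelfAdjoint ((Real.pi : ℝ) • h) := (IsSelfAdjoint.all _).smul hh
  have := (selfAdjoint.expUnitary ⟨(Real.pi : ℝ) • h, hs⟩).2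
  rw [selfAdjoint.expUnitary_coe] at this
  convert this using 2
  simp [mul_comm, mul_smul]

/-- The unitaries `exp (π i h)` for a bounded family of self-adjoint elements. -/
def expFun (h : I → E) (hs : ∀ i, IsSelfAdjoint (h i)) : I → unitary E :=
  fun i => ⟨_, isUnitary_exp_pi_mul (hs i)⟩

/-- An idempotent satisfies exp(πih) = 1 - 2h. Here h is idempotent only in front of x, so the
argument is termwise: each (h^m - h)x is null along L, and dominated convergence sums these terms.
-/
theorem cls_expFun_mul {L : Filter I} (h : BddFun I E) (hs : ∀ i, IsSelfAdjoint (h.1 i))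
    (x : BddFun I E) (hx : cls L h * (cls L h * cls L x) = cls L h * cls L x) :
    cls L (unitaryFun (expFun h.1 hs)) * cls L x = cls L x - 2 * (cls L h * cls L x) := by
  obtain ⟨C, hC⟩ := h.2
  obtain ⟨D, hD⟩ := x.2
  have hpow : ∀ m : ℕ, m ≠ 0 → cls L h ^ m * cls L x = cls L h * cls L x := by
    intro m hm
    induction m with
    | zero => exact absurd rfl hm
    | succ k ih =>
      rcases eq_or_ne k 0 with rfl | hk
      · simp
      · rw [pow_succ', mul_assoc, ih hk, hx]
  have key : Tendsto (fun i => ∑' m, expDefect (h.1 i) m * x.1 i) L (𝓝 (∑' _ : ℕ, (0 : E))) := by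
    refine tendsto_tsum_of_dominated_convergence
      (bound := fun m => 2 * max C 1 * ((m.factorial⁻¹ : ℝ) * (Real.pi * max C 1) ^ m) * D)
      ((summable_expDefect_bound _).mul_right D) (fun m => ?_) (Eventually.of_forall fun i m => ?_)
    · rcases eq_or_ne m 0 with rfl | hm
      · simpa [expDefect] using tendsto_const_nhds
      · have := hpow m hm
        rw [← map_pow, ← map_mul, ← map_mul, cls_eq_iff] at this
        have := this.const_smul ((m.factorial⁻¹ : ℂ) * (Real.pi * Complex.I) ^ m)
        simpa [expDefect, hm, smul_mul_assoc, sub_mul] using this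
    · exact (norm_mul_le _ _).trans (mul_le_mul
        (norm_expDefect_le (le_max_right _ _) ((hC i).trans (le_max_left _ _)) m) (hD i)
        (norm_nonneg _) (by positivity))
  have h2 : cls L x - 2 * (cls L h * cls L x) = cls L (x - 2 * (h * x)) := by
    simp [two_mul]
  rw [h2, ← map_mul, cls_eq_iff]
  rw [tsum_zero] at key
  refine key.congr fun i => ?_
  rw [((hasSum_expDefect (h.1 i)).mul_right (x.1 i)).tsum_eq]
  simp [unitaryFun, expFun, two_smul, two_mul]
  noncomm_ring

/-- Polar decomposition: the unitary is U(U*U)^{-1/2}. The second hypothesis makes U invertible, so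
that this isometry is unitary. -/
theorem exists_unitary_norm_sub_le {U : E} (h1 : ‖star U * U - 1‖ ≤ 1 / 2)
    (h2 : ‖U * star U - 1‖ ≤ 1 / 2) :
    ∃ u : unitary E, ‖(u : E) - U‖ ≤ 2 * ‖U‖ * ‖star U * U - 1‖ := by
  rcases subsingleton_or_nontrivial E with hE | hE
  · exact ⟨1, by simp [Subsingleton.elim (_ : E) 0]⟩
  have unit_of : ∀ y : E, ‖y - 1‖ ≤ 1 / 2 → IsUnit y := fun y hy => by
    have := (Units.oneSub (1 - y) (by rw [norm_sub_rev]; linarith)).isUnit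
    simpa using this
  have hx := unit_of _ h1
  have hU : IsUnit U := by
    obtain ⟨a, ha⟩ := hx
    obtain ⟨b, hb⟩ := unit_of _ h2
    refine isUnit_iff_exists_and_exists.2 ⟨⟨star U * ↑b⁻¹, ?_⟩, ⟨↑a⁻¹ * star U, ?_⟩⟩
    · rw [← mul_assoc, ← hb, Units.mul_inv]
    · rw [mul_assoc, ← ha, Units.inv_mul]
  set x := star U * U with hxdef
  have hsa : IsSelfAdjoint x := IsSelfAdjoint.star_mul_self U
  have hspec : ∀ t ∈ spectrum ℝ x, |t - 1| ≤ ‖x - 1‖ := by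
    intro t ht
    have : t - 1 ∈ spectrum ℝ (x - 1) := by
      have := spectrum.sub_singleton_eq (R := ℝ) x 1
      rw [map_one] at this
      rw [← this]
      exact Set.sub_mem_sub ht rfl
    simpa using spectrum.norm_le_norm_of_mem this
  have hpos : ∀ t ∈ spectrum ℝ x, 1 / 2 ≤ t := by
    intro t ht
    have := abs_le.1 ((hspec t ht).trans h1)
    linarith
  let f : ℝ → ℝ := fun t => (Real.sqrt t)⁻¹
  have hf : ContinuousOn f (spectrum ℝ x) :=
    Real.continuous_sqrt.continuousOn.inv₀ fun t ht =>
      (Real.sqrt_pos.2 (by linarith [hpos t ht])).ne'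
  set r := cfc f x
  have hr : IsSelfAdjoint r := cfc_predicate f x
  have hrxr : r * x * r = 1 := by
    conv_lhs => rw [← cfc_id' ℝ x]
    rw [← cfc_mul f _ x hf, ← cfc_mul (fun t => f t * t) f x (hf.mul continuousOn_id) hf, ← cfc_one ℝ x]
    refine cfc_congr fun t ht => ?_
    have h0 : 0 < t := by linarith [hpos t ht]
    have h4 : (0:ℝ) < Real.sqrt t := Real.sqrt_pos.2 h0
    simp only [f, Pi.one_apply]
    field_simp
    exact (Real.sq_sqrt h0.le).symm
  have hr1 : ‖r - 1‖ ≤ 2 * ‖x - 1‖ := by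
    have h3 : r - 1 = cfc (fun t => f t - 1) x := by
      rw [cfc_sub f (fun _ => 1) x hf, cfc_const_one ℝ x]
    rw [h3]
    refine norm_cfc_le (by positivity) fun t ht => ?_
    have h0 := hpos t ht
    have h4 : (1 / 2:ℝ) ≤ Real.sqrt t := Real.le_sqrt_of_sq_le (by linarith)
    have h5 := Real.sq_sqrt (show 0 ≤ t by linarith)
    refine le_trans ?_ (mul_le_mul_of_nonneg_left (hspec t ht) zero_le_two)
    -- For t ≥ 1/2 the two factors (√t)⁻¹ and (1 + √t)⁻¹ are at most 2 and 1, which is the source of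
    -- the constant 2.
    have h6 : f t - 1 = (1 - t) * ((Real.sqrt t)⁻¹ * (1 + Real.sqrt t)⁻¹) := by
      simp only [f]
      have : 1 - t = (1 - Real.sqrt t) * (1 + Real.sqrt t) := by ring_nf; rw [h5]
      rw [this]
      field_simp
    have h7 : (Real.sqrt t)⁻¹ ≤ 2 := by
      rw [inv_le_comm₀ (by linarith) (by norm_num)]; linarith
    have h8 : (1 + Real.sqrt t)⁻¹ ≤ 1 := inv_le_one_of_one_le₀ (by linarith)
    have h9 : (Real.sqrt t)⁻¹ * (1 + Real.sqrt t)⁻¹ ≤ 2 * 1 :=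
      mul_le_mul h7 h8 (by positivity) (by norm_num)
    rw [h6, Real.norm_eq_abs, abs_mul, abs_sub_comm 1 t,
      abs_of_nonneg (a := (Real.sqrt t)⁻¹ * (1 + Real.sqrt t)⁻¹) (by positivity)]
    nlinarith [abs_nonneg (t - 1)]
  have hru : IsUnit r := by
    refine isUnit_iff_exists_and_exists.2 ⟨⟨x * r, ?_⟩, ⟨r * x, hrxr⟩⟩
    rw [← mul_assoc, hrxr]
  have hV : star (U * r) * (U * r) = 1 := by
    rw [star_mul, hr.star_eq, mul_assoc, ← mul_assoc (star U), ← hxdef, ← mul_assoc, hrxr]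
  have hV' : (U * r) * star (U * r) = 1 := by
    obtain ⟨v, hv⟩ := hU.mul hru
    rw [← hv] at hV ⊢
    rw [← Units.inv_eq_of_mul_eq_one_left hV, Units.mul_inv]
  refine ⟨⟨U * r, Unitary.mem_iff.2 ⟨hV, hV'⟩⟩, ?_⟩
  calc ‖U * r - U‖ = ‖U * (r - 1)‖ := by rw [mul_sub, mul_one]
    _ ≤ ‖U‖ * (2 * ‖x - 1‖) := (norm_mul_le _ _).trans (by gcongr)
    _ = _ := by ring

theorem exists_unitaryFun_cls_eq {L : Filter I} (U : BddFun I E)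
    (h1 : cls L (bstar U) * cls L U = 1) (h2 : cls L U * cls L (bstar U) = 1) :
    ∃ u : I → unitary E, cls L (unitaryFun u) = cls L U := by
  obtain ⟨C, hC⟩ := U.2
  have h1' : Tendsto (fun i => ‖star (U.1 i) * U.1 i - 1‖) L (𝓝 0) := by
    rw [← map_mul, ← map_one (cls L), cls_eq_iff] at h1
    have h := h1.norm
    rwa [norm_zero] at h
  have h2' : Tendsto (fun i => ‖U.1 i * star (U.1 i) - 1‖) L (𝓝 0) := by
    rw [← map_mul, ← map_one (cls L), cls_eq_iff] at h2
    have h := h2.norm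
    rwa [norm_zero] at h
  have : ∀ i, ∃ u : unitary E, ‖star (U.1 i) * U.1 i - 1‖ ≤ 1 / 2 →
      ‖U.1 i * star (U.1 i) - 1‖ ≤ 1 / 2 →
      ‖(u : E) - U.1 i‖ ≤ 2 * ‖U.1 i‖ * ‖star (U.1 i) * U.1 i - 1‖ := by
    intro i
    by_cases ha : ‖star (U.1 i) * U.1 i - 1‖ ≤ 1 / 2 ∧ ‖U.1 i * star (U.1 i) - 1‖ ≤ 1 / 2
    · obtain ⟨u, hu⟩ := exists_unitary_norm_sub_le ha.1 ha.2
      exact ⟨u, fun _ _ => hu⟩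
    -- A default value: along L such indices eventually do not occur.
    · exact ⟨1, fun h h' => absurd ⟨h, h'⟩ ha⟩
  choose u hu using this
  refine ⟨u, cls_eq_iff.2 ?_⟩
  have h3 : Tendsto (fun i => 2 * C * ‖star (U.1 i) * U.1 i - 1‖) L (𝓝 0) := by
    simpa using h1'.const_mul (2 * C)
  refine squeeze_zero_norm' ?_ h3
  filter_upwards [h1'.eventually_le_const (show (0:ℝ) < 1 / 2 by norm_num),
    h2'.eventually_le_const (show (0:ℝ) < 1 / 2 by norm_num)] with i hi1 hi2
  refine (hu i hi1 hi2).trans ?_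
  gcongr
  exact hC i

end SequenceQuotient

/-! ### Matrix units relative to a set, and the flip of two commuting systems. -/

section RelativeMatrixUnits

variable {Q ι : Type*} [Ring Q] [Fintype ι] [DecidableEq ι]

/-- Elements of a ring that commute with a set `X` and satisfy the relations of a unital system of
matrix units after multiplication by elements of `X`. -/
structure RelMatUnits (X : Set Q) (e : ι → ι → Q) : Prop where
  comm : ∀ i j, ∀ x ∈ X, e i j * x = x * e i j
  mul : ∀ i j k l, ∀ x ∈ X, e i j * (e k l * x) = if j = k then e i l * x else 0
  one : ∀ x ∈ X, ∑ i, e i i * x = x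

/-- The element exchanging two commuting systems of matrix units. -/
def flipElt (e f : ι → ι → Q) : Q := ∑ i, ∑ j, f i j * e j i

variable {X : Set Q} {e f : ι → ι → Q}

theorem RelMatUnits.mono {Y : Set Q} (he : RelMatUnits X e) (h : Y ⊆ X) : RelMatUnits Y e :=
  ⟨fun i j x hx => he.comm i j x (h hx), fun i j k l x hx => he.mul i j k l x (h hx),
    fun x hx => he.one x (h hx)⟩

theorem RelMatUnits.reindex (he : RelMatUnits X e) (σ : Equiv.Perm ι) :
    RelMatUnits X fun i j => e (σ i) (σ j) where
  comm i j := he.comm _ _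
  mul i j k l x hx := by simp [he.mul _ _ _ _ x hx]
  one x hx := by rw [Equiv.sum_comp σ fun i => e i i * x]; exact he.one x hx

theorem flipElt_comm (he : RelMatUnits X e) (hf : RelMatUnits X f) {x : Q} (hx : x ∈ X) :
    flipElt e f * x = x * flipElt e f := by
  simp only [flipElt, Finset.sum_mul, Finset.mul_sum]
  refine Finset.sum_congr rfl fun i _ => Finset.sum_congr rfl fun j _ => ?_
  rw [mul_assoc, he.comm _ _ x hx, ← mul_assoc, hf.comm _ _ x hx, mul_assoc]

theorem flipElt_mul_left (he : RelMatUnits X e) (hf : RelMatUnits X f)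
    (hc : ∀ i j k l, e i j * f k l = f k l * e i j) {x : Q} (hx : x ∈ X) (k l : ι) :
    flipElt e f * (f k l * x) = ∑ i, f i l * (e k i * x) := by
  have h : ∀ i j, f i j * e j i * (f k l * x) =
      if j = k then f i l * (e j i * x) else 0 := by
    intro i j
    calc f i j * e j i * (f k l * x) = f i j * (e j i * f k l) * x := by noncomm_ring
      _ = f i j * (f k l * (e j i * x)) := by rw [hc]; noncomm_ring
      _ = (f i j * (f k l * x)) * e j i := by rw [he.comm _ _ x hx]; noncomm_ring
      _ = _ := by
        rw [hf.mul _ _ _ _ x hx]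
        split_ifs
        · rw [mul_assoc, he.comm _ _ x hx]
        · simp
  simp [flipElt, Finset.sum_mul, h]

/-- In the model M_n ⊗ M_n the element `flipElt e f` is the tensor flip, so it intertwines the two
factors. Both sides equal Σ_i f_{il} e_{ki} x. -/
theorem flipElt_conj (he : RelMatUnits X e) (hf : RelMatUnits X f)
    (hc : ∀ i j k l, e i j * f k l = f k l * e i j) {x : Q} (hx : x ∈ X) (k l : ι) :
    flipElt e f * (f k l * x) = e k l * (flipElt e f * x) := by
  rw [flipElt_mul_left he hf hc hx]
  have h : ∀ i j, e k l * (f i j * e j i * x) = if l = j then f i j * (e k i * x) else 0 := by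
    intro i j
    calc e k l * (f i j * e j i * x) = (e k l * f i j) * (e j i * x) := by noncomm_ring
      _ = f i j * (e k l * (e j i * x)) := by rw [hc]; noncomm_ring
      _ = _ := by rw [he.mul _ _ _ _ x hx]; simp
  simp [flipElt, Finset.sum_mul, Finset.mul_sum, h]

/-- The orthogonality relations collapse the product to Σ_l f_{ll} (Σ_k e_{kk} x), and the unit
relations of both systems finish. -/
theorem flipElt_mul_self (he : RelMatUnits X e) (hf : RelMatUnits X f)
    (hc : ∀ i j k l, e i j * f k l = f k l * e i j) {x : Q} (hx : x ∈ X) :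
    flipElt e f * (flipElt e f * x) = x := by
  calc flipElt e f * (flipElt e f * x)
      = ∑ k, ∑ l, flipElt e f * (f k l * x) * e l k := by
        conv_lhs => rw [flipElt_comm he hf hx]
        rw [← mul_assoc]
        nth_rw 2 [flipElt]
        simp only [Finset.mul_sum]
        refine Finset.sum_congr rfl fun i _ => Finset.sum_congr rfl fun j _ => ?_
        rw [← mul_assoc, mul_assoc _ x, ← hf.comm _ _ x hx]
    _ = ∑ k, ∑ l, ∑ i, if i = l then f i l * (e k k * x) else 0 := by
        refine Finset.sum_congr rfl fun k _ => Finset.sum_congr rfl fun l _ => ?_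
        rw [flipElt_mul_left he hf hc hx, Finset.sum_mul]
        refine Finset.sum_congr rfl fun i _ => ?_
        rw [mul_assoc, mul_assoc, ← he.comm _ _ x hx, he.mul _ _ _ _ x hx]
        simp
    _ = ∑ l, f l l * x := by
        rw [Finset.sum_comm]
        refine Finset.sum_congr rfl fun l _ => ?_
        simp only [Finset.sum_ite_eq', Finset.mem_univ, if_true]
        rw [← Finset.mul_sum, he.one x hx]
    _ = x := hf.one x hx

end RelativeMatrixUnits

/-! ### Symmetries relative to a set are implemented by unitaries. -/

section SymmetryLift

variable {I E : Type*} [CStarAlgebra E]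

/-- The constant function `1/2`. -/
def halfFun : BddFun I E := ⟨fun _ => (1 / 2 : ℂ) • 1, _, fun _ => le_rfl⟩

theorem halfFun_add_self : (halfFun : BddFun I E) + halfFun = 1 :=
  Subtype.ext <| funext fun i => by
    change (1 / 2 : ℂ) • (1 : E) + (1 / 2 : ℂ) • 1 = 1
    rw [← add_smul]
    norm_num

theorem halfFun_comm (x : BddFun I E) : halfFun * x = x * halfFun :=
  Subtype.ext <| funext fun i => by
    change (1 / 2 : ℂ) • (1 : E) * x.1 i = x.1 i * (1 / 2 : ℂ) • (1 : E)
    simp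

theorem bstar_halfFun : bstar (halfFun : BddFun I E) = halfFun :=
  Subtype.ext <| funext fun i => by
    change star ((1 / 2 : ℂ) • (1 : E)) = (1 / 2 : ℂ) • (1 : E)
    simp

theorem bstar_add (x y : BddFun I E) : bstar (x + y) = bstar x + bstar y :=
  Subtype.ext <| funext fun _ => star_add _ _

theorem bstar_sub (x y : BddFun I E) : bstar (x - y) = bstar x - bstar y :=
  Subtype.ext <| funext fun _ => star_sub _ _

theorem bstar_one : bstar (1 : BddFun I E) = 1 :=
  Subtype.ext <| funext fun _ => star_one _

/-- For h = (1 - s)/2 the relation s²x = x says h²x = hx, so exp(πih) acts on x as 1 - 2h = s. Polar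
decomposition of s would not do, since s is unitary only in front of such x. -/
theorem exists_unitaryFun_of_symmetry {L : Filter I} (s : BddFun I E)
    (hs : cls L (bstar s) = cls L s) :
    ∃ u : I → unitary E, ∀ x : BddFun I E, cls L s * (cls L s * cls L x) = cls L x →
      cls L (unitaryFun u) * cls L x = cls L s * cls L x := by
  -- Averaging s with its adjoint makes every value of h self-adjoint, and not just self-adjoint up
  -- to a null function.
  set h : BddFun I E := halfFun * (1 - halfFun * (s + bstar s)) with hh
  have hsa : bstar h = h := by
    rw [hh, bstar_mul, bstar_sub, bstar_mul, bstar_add, bstar_bstar, bstar_one, bstar_halfFun,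
      ← halfFun_comm, ← halfFun_comm, add_comm (bstar s)]
  have hsa' : ∀ i, IsSelfAdjoint (h.1 i) := fun i => congrFun (congrArg Subtype.val hsa) i
  set k : SeqQuot L E := cls L halfFun
  have hk : k + k = 1 := by rw [← map_add, halfFun_add_self, map_one]
  have hkc : ∀ x : BddFun I E, k * cls L x = cls L x * k := fun x => by
    rw [← map_mul, halfFun_comm, map_mul]
  have hcls : cls L h = k * (1 - cls L s) := by
    rw [hh, map_mul, map_sub, map_mul, map_add, hs, map_one, mul_add, ← add_mul, hk, one_mul]
  refine ⟨expFun h.1 hsa', fun x hx => ?_⟩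
  have h1 : cls L h * (cls L h * cls L x) = cls L h * cls L x := by
    have h2 : (1 - cls L s) * k = k * (1 - cls L s) := by
      rw [sub_mul, mul_sub, hkc, one_mul, mul_one]
    calc cls L h * (cls L h * cls L x)
        = k * ((1 - cls L s) * k) * ((1 - cls L s) * cls L x) := by rw [hcls]; noncomm_ring
      _ = k * k * (cls L x - cls L s * cls L x - cls L s * cls L x
          + cls L s * (cls L s * cls L x)) := by rw [h2]; noncomm_ring
      _ = k * ((k + k) * (cls L x - cls L s * cls L x)) := by rw [hx]; noncomm_ring
      _ = _ := by rw [hk, hcls]; noncomm_ring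
  rw [cls_expFun_mul h hsa' x h1, hcls]
  calc cls L x - 2 * (k * (1 - cls L s) * cls L x)
      = cls L x - (k + k) * ((1 - cls L s) * cls L x) := by noncomm_ring
    _ = _ := by rw [hk]; noncomm_ring

/-- A self-adjoint element whose square is one relative to a self-adjoint set commuting with it
acts on that set like a family of unitaries. -/
theorem exists_unitaryFun_symmetry {L : Filter I} (s : BddFun I E)
    (hs : cls L (bstar s) = cls L s) {X : Set (BddFun I E)} (hX : ∀ x ∈ X, bstar x ∈ X)
    (hsq : ∀ x ∈ X, cls L s * (cls L s * cls L x) = cls L x)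
    (hcomm : ∀ x ∈ X, cls L s * cls L x = cls L x * cls L s) :
    ∃ u : I → unitary E, ∀ x ∈ X, cls L (unitaryFun u) * cls L x = cls L s * cls L x ∧
      cls L (unitaryFun u) * cls L x = cls L x * cls L (unitaryFun u) := by
  obtain ⟨u, hu⟩ := exists_unitaryFun_of_symmetry s hs
  refine ⟨u, fun x hx => ⟨hu x (hsq x hx), ?_⟩⟩
  -- The product x u is reached through adjoints: on X the adjoint of u also acts as s, because u
  -- does and s² = 1 there.
  have hstar : ∀ y ∈ X, cls L (bstar (unitaryFun u)) * cls L y = cls L s * cls L y := by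
    intro y hy
    have h1 := hu (s * y) (by rw [map_mul, hsq y hy])
    rw [map_mul, hsq y hy] at h1
    rw [← h1, ← mul_assoc, ← map_mul, bstar_mul_unitaryFun, map_one, one_mul, h1]
  have h2 := hstar _ (hX x hx)
  rw [← map_mul, ← map_mul] at h2
  have h3 := cls_bstar_congr h2
  rw [bstar_mul, bstar_mul, bstar_bstar, bstar_bstar, map_mul, map_mul, hs] at h3
  rw [h3, hu x (hsq x hx), hcomm x hx]

end SymmetryLift

/-! ### Approximately central matrix units from UHF absorption. -/

section CentralMatrixUnits

/-- A net of approximately central, approximately unital systems of matrix units. -/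
structure CentralMatrixUnits {A T ι : Type*} [NonUnitalCStarAlgebra A] [Fintype ι]
    [DecidableEq ι] (l : Filter T) (e : T → ι → ι → A) : Prop where
  norm_le : ∀ t i j, ‖e t i j‖ ≤ 1
  star_eq : ∀ t i j, star (e t i j) = e t j i
  comm : ∀ i j a, Tendsto (fun t => e t i j * a - a * e t i j) l (𝓝 0)
  mul : ∀ i j k m a,
    Tendsto (fun t => e t i j * (e t k m * a) - if j = k then e t i m * a else 0) l (𝓝 0)
  one : ∀ a, Tendsto (fun t => ∑ i, e t i i * a - a) l (𝓝 0)

theorem CentralMatrixUnits.map {A B T ι κ : Type*} [NonUnitalCStarAlgebra A]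
    [NonUnitalCStarAlgebra B] [Fintype ι] [DecidableEq ι] [Fintype κ] [DecidableEq κ]
    {l : Filter T} {e : T → ι → ι → A} (he : CentralMatrixUnits l e) (φ : A ≃⋆ₐ[ℂ] B)
    (σ : κ ≃ ι) : CentralMatrixUnits l fun t i j => φ (e t (σ i) (σ j)) := by
  have hφ : ∀ {f : T → A}, Tendsto f l (𝓝 0) → Tendsto (fun t => φ (f t)) l (𝓝 0) :=
    fun {f} hf => squeeze_zero_norm (fun t => NonUnitalStarAlgHom.norm_apply_le φ (f t))
      (by simpa using hf.norm)
  refine ⟨fun t i j => ?_, fun t i j => ?_, fun i j a => ?_, fun i j k m a => ?_, fun a => ?_⟩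
  · exact (NonUnitalStarAlgHom.norm_apply_le φ _).trans (he.norm_le _ _ _)
  · rw [← map_star, he.star_eq]
  · simpa using hφ (he.comm (σ i) (σ j) (φ.symm a))
  · refine (hφ (he.mul (σ i) (σ j) (σ k) (σ m) (φ.symm a))).congr fun t => ?_
    split_ifs <;> simp_all
  · refine (hφ (he.one (φ.symm a))).congr fun t => ?_
    rw [← Equiv.sum_comp σ]
    simp

theorem tendsto_zero_of_dense {M B T : Type*} [SeminormedAddCommGroup M]
    [SeminormedAddCommGroup B] {l : Filter T} (Φ : T → M →+ B) (C : ℝ)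
    (hΦ : ∀ t m, ‖Φ t m‖ ≤ C * ‖m‖) {S : Set M} (hS : Dense S)
    (h : ∀ m ∈ S, Tendsto (fun t => Φ t m) l (𝓝 0)) (m : M) :
    Tendsto (fun t => Φ t m) l (𝓝 0) := by
  rw [Metric.tendsto_nhds]
  intro ε hε
  obtain ⟨m', hm', hd⟩ := hS.exists_dist_lt m (show 0 < ε / (2 * (|C| + 1)) by positivity)
  filter_upwards [Metric.tendsto_nhds.1 (h m' hm') (ε / 2) (half_pos hε)] with t ht
  rw [dist_zero_right] at ht ⊢
  have h1 : Φ t m = Φ t (m - m') + Φ t m' := by rw [map_sub, sub_add_cancel]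
  have h2 : ‖Φ t (m - m')‖ ≤ ε / 2 := by
    rw [dist_eq_norm] at hd
    calc _ ≤ C * ‖m - m'‖ := hΦ _ _
      _ ≤ (|C| + 1) * (ε / (2 * (|C| + 1))) := by
        have := le_abs_self C
        gcongr
        linarith
      _ = ε / 2 := by field_simp
  rw [h1]
  exact (norm_add_le _ _).trans_lt (by linarith)

section SiteMatrixUnits

variable {q : ℕ}

theorem siteMatrixUnit_apply (k : ℕ) (i j : Fin q) (ξ : EllTwo (ℕ → Fin q)) (s : ℕ → Fin q) :
    siteMatrixUnit q k i j ξ s = if s k = i then ξ (Function.update s k j) else 0 := rfl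

theorem norm_siteMatrixUnit_le (k : ℕ) (i j : Fin q) : ‖siteMatrixUnit q k i j‖ ≤ 1 :=
  LinearMap.mkContinuous_norm_le _ zero_le_one _

theorem siteMatrixUnit_mul (k : ℕ) (i j i' j' : Fin q) :
    siteMatrixUnit q k i j * siteMatrixUnit q k i' j' =
      if j = i' then siteMatrixUnit q k i j' else 0 := by
  ext ξ s
  rw [mul_apply_eq_comp, siteMatrixUnit_apply]
  by_cases hj : j = i'
  · simp [siteMatrixUnit_apply, hj]
  · by_cases hs : s k = i <;> simp [siteMatrixUnit_apply, hj, hs]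

theorem siteMatrixUnit_commute {k l : ℕ} (hkl : k ≠ l) (i j i' j' : Fin q) :
    siteMatrixUnit q k i j * siteMatrixUnit q l i' j' =
      siteMatrixUnit q l i' j' * siteMatrixUnit q k i j := by
  ext ξ s
  simp only [mul_apply_eq_comp, siteMatrixUnit_apply,
    Function.update_of_ne hkl, Function.update_of_ne hkl.symm, Function.update_comm hkl]
  split_ifs <;> rfl

theorem sum_siteMatrixUnit (k : ℕ) : ∑ i, siteMatrixUnit q k i i = 1 := by
  ext ξ s
  have h : ∀ (F : Finset (Fin q)), (∑ i ∈ F, siteMatrixUnit q k i i) ξ s =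
      ∑ i ∈ F, if s k = i then ξ (Function.update s k i) else 0 := by
    intro F
    induction F using Finset.induction_on with
    | empty => simp
    | insert a F ha ih =>
      rw [Finset.sum_insert ha, Finset.sum_insert ha, ← ih, ← siteMatrixUnit_apply]
      rfl
  rw [h]
  simp

theorem star_siteMatrixUnit (k : ℕ) (i j : Fin q) :
    star (siteMatrixUnit q k i j) = siteMatrixUnit q k j i := by
  rw [ContinuousLinearMap.star_eq_adjoint]
  symm
  rw [ContinuousLinearMap.eq_adjoint_iff]
  intro ξ η
  rw [lp.inner_eq_tsum, lp.inner_eq_tsum]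
  -- Exchanging the values i and j at site k permutes the index set and matches the nonzero terms of
  -- the two series.
  let π : Equiv.Perm (ℕ → Fin q) :=
    Function.Involutive.toPerm (fun s => Function.update s k (Equiv.swap i j (s k))) fun s => by
      simp
  rw [← Equiv.tsum_eq π]
  refine tsum_congr fun s => ?_
  have hπ : π s = Function.update s k (Equiv.swap i j (s k)) := rfl
  rw [siteMatrixUnit_apply, siteMatrixUnit_apply, hπ]
  by_cases hs : s k = i
  · subst hs
    simp
  · have : Equiv.swap i j (s k) ≠ j := by
      intro h
      rw [Equiv.swap_apply_eq_iff, Equiv.swap_apply_right] at h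
      exact hs h
    simp [hs, this]

/-- The matrix units of the tensor factors, as elements of the UHF algebra. -/
def uhfUnit (q k : ℕ) (i j : Fin q) : UHF q :=
  ⟨siteMatrixUnit q k i j, StarSubalgebra.le_topologicalClosure _
    (StarAlgebra.subset_adjoin ℂ _ ⟨k, i, j, rfl⟩)⟩

/-- Matrix units of different tensor factors commute, and an element of the *-algebra involves only
finitely many factors. -/
theorem eventually_uhfUnit_commute {x : EllTwo (ℕ → Fin q) →L[ℂ] EllTwo (ℕ → Fin q)}
    (hx : x ∈ StarAlgebra.adjoin ℂ {T | ∃ (k : ℕ) (i j : Fin q), T = siteMatrixUnit q k i j}) :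
    ∀ᶠ n in atTop, ∀ i j, siteMatrixUnit q n i j * x = x * siteMatrixUnit q n i j := by
  induction hx using StarAlgebra.adjoin_induction with
  | mem x hx =>
    obtain ⟨k, i, j, rfl⟩ := hx
    filter_upwards [eventually_gt_atTop k] with n hn i' j'
    exact siteMatrixUnit_commute hn.ne' _ _ _ _
  | algebraMap r =>
    exact Eventually.of_forall fun n i j => (Algebra.commutes r _).symm
  | add x y _ _ hx hy =>
    filter_upwards [hx, hy] with n h1 h2 i j
    rw [mul_add, add_mul, h1, h2]
  | mul x y _ _ hx hy =>
    filter_upwards [hx, hy] with n h1 h2 i j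
    rw [← mul_assoc, h1, mul_assoc, h2, mul_assoc]
  | star x _ hx =>
    filter_upwards [hx] with n h i j
    have := congrArg star (h j i)
    rw [star_mul, star_mul, star_siteMatrixUnit] at this
    exact this.symm

theorem dense_adjoin_siteMatrixUnit :
    Dense {x : UHF q | x.1 ∈ StarAlgebra.adjoin ℂ
      {T | ∃ (k : ℕ) (i j : Fin q), T = siteMatrixUnit q k i j}} := by
  rw [Metric.dense_iff]
  rintro ⟨x, hx⟩ r hr
  have hx' : x ∈ closure (StarAlgebra.adjoin ℂ
      {T | ∃ (k : ℕ) (i j : Fin q), T = siteMatrixUnit q k i j} : Set _) := hx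
  obtain ⟨y, hy, hd⟩ := Metric.mem_closure_iff.1 hx' r hr
  refine ⟨⟨y, StarSubalgebra.le_topologicalClosure _ hy⟩, ?_, hy⟩
  rw [Metric.mem_ball, dist_comm]
  exact hd

end SiteMatrixUnits

/-- Writing ‖x‖² - x*x = y*y gives (x⊗a)*(x⊗a) ≤ ‖x‖² (1⊗a)*(1⊗a) after applying j, and a ↦ j(1⊗a)
is contractive, being a *-homomorphism of C*-algebras. No continuity of j is needed. -/
theorem norm_tensorHom_tmul_le {C A B : Type*} [CStarAlgebra C] [NonUnitalCStarAlgebra A]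
    [NonUnitalCStarAlgebra B] (j : C ⊗[ℂ] A →⋆ₙₐ[ℂ] B) (x : C) (a : A) :
    ‖j (x ⊗ₜ a)‖ ≤ ‖x‖ * ‖a‖ := by
  let := CStarAlgebra.spectralOrder C
  let := CStarAlgebra.spectralOrderedRing C
  let := CStarAlgebra.spectralOrder B
  let := CStarAlgebra.spectralOrderedRing B
  let φ : A →⋆ₙₐ[ℂ] B :=
    { toFun := fun b => j (1 ⊗ₜ b)
      map_smul' := fun c b => by simp [TensorProduct.tmul_smul]
      map_zero' := by simp
      map_add' := fun b c => by simp [TensorProduct.tmul_add]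
      map_mul' := fun b c => by simp [← map_mul]
      map_star' := fun b => by simp [← map_star] }
  have hmul : ∀ (y : C), star (j (y ⊗ₜ a)) * j (y ⊗ₜ a) = j ((star y * y) ⊗ₜ (star a * a)) := by
    intro y
    rw [← map_star, ← map_mul, TensorProduct.star_tmul, Algebra.TensorProduct.tmul_mul_tmul]
  have h1 : 0 ≤ algebraMap ℂ C ((‖x‖ : ℂ) ^ 2) - star x * x := by
    have h := CStarAlgebra.star_mul_le_algebraMap_norm_sq (a := x)
    have h' : algebraMap ℝ C (‖x‖ ^ 2) = algebraMap ℂ C ((‖x‖ : ℂ) ^ 2) := by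
      rw [IsScalarTower.algebraMap_apply ℝ ℂ C]
      simp
    rwa [h', ← sub_nonneg] at h
  obtain ⟨y, hy⟩ := CStarAlgebra.nonneg_iff_eq_star_mul_self.1 h1
  have h2 : star (j (x ⊗ₜ a)) * j (x ⊗ₜ a) ≤ ((‖x‖ : ℂ) ^ 2) • (star (φ a) * φ a) := by
    have h3 : ((‖x‖ : ℂ) ^ 2) • (star (φ a) * φ a) - star (j (x ⊗ₜ a)) * j (x ⊗ₜ a) =
        star (j (y ⊗ₜ a)) * j (y ⊗ₜ a) := by
      change ((‖x‖ : ℂ) ^ 2) • (star (j (1 ⊗ₜ a)) * j (1 ⊗ₜ a)) - _ = _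
      rw [hmul, hmul, hmul, ← hy, TensorProduct.sub_tmul, map_sub, star_one, one_mul,
        ← map_smul, TensorProduct.smul_tmul', Algebra.algebraMap_eq_smul_one]
    rw [← sub_nonneg, h3]
    exact star_mul_self_nonneg _
  have h4 := CStarAlgebra.norm_le_norm_of_nonneg_of_le (star_mul_self_nonneg _) h2
  rw [CStarRing.norm_star_mul_self, norm_smul, CStarRing.norm_star_mul_self] at h4
  have h5 := NonUnitalStarAlgHom.norm_apply_le φ a
  have h6 : ‖(‖x‖ : ℂ) ^ 2‖ = ‖x‖ ^ 2 := by simp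
  rw [h6] at h4
  refine abs_le_of_sq_le_sq' (a := ‖j (x ⊗ₜ a)‖) ?_ (by positivity) |>.2
  calc ‖j (x ⊗ₜ a)‖ ^ 2 ≤ ‖x‖ ^ 2 * (‖φ a‖ * ‖φ a‖) := by rw [sq]; exact h4
    _ ≤ ‖x‖ ^ 2 * (‖a‖ * ‖a‖) := by gcongr
    _ = _ := by ring

theorem exists_approximateUnit (A : Type*) [NonUnitalCStarAlgebra A] :
    ∃ l : Filter {h : A // star h = h ∧ ‖h‖ ≤ 1}, l.NeBot ∧
      ∀ a : A, Tendsto (fun h : {h : A // star h = h ∧ ‖h‖ ≤ 1} => h.1 * a) l (𝓝 a) ∧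
        Tendsto (fun h : {h : A // star h = h ∧ ‖h‖ ≤ 1} => a * h.1) l (𝓝 a) := by
  let := CStarAlgebra.spectralOrder A
  let := CStarAlgebra.spectralOrderedRing A
  have hu := CStarAlgebra.increasingApproximateUnit A
  have := hu.neBot
  refine ⟨comap Subtype.val (CStarAlgebra.approximateUnit A), ?_, fun a => ⟨?_, ?_⟩⟩
  · refine NeBot.comap_of_range_mem ‹_› ?_
    filter_upwards [hu.eventually_star_eq, hu.eventually_norm] with h h1 h2
    exact ⟨⟨h, h1, h2⟩, rfl⟩
  · exact (hu.tendsto_mul_right a).comp tendsto_comap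
  · exact (hu.tendsto_mul_left a).comp tendsto_comap

/-- The units are j(u_n ⊗ h), where n → ∞ gives asymptotic commutation with C, and h runs through an
approximate unit of A. They are contractions, so every relation need only be tested on elementary
tensors. -/
theorem exists_centralMatrixUnits_of_tensor {ι : Type*} [Fintype ι] [DecidableEq ι]
    {C : Type*} {A B : Type v} [CStarAlgebra C] [NonUnitalCStarAlgebra A]
    [NonUnitalCStarAlgebra B] (j : C ⊗[ℂ] A →⋆ₙₐ[ℂ] B) (hj : DenseRange j)
    (u : ℕ → ι → ι → C) (hub : ∀ n i k, ‖u n i k‖ ≤ 1) (hus : ∀ n i k, star (u n i k) = u n k i)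
    (hum : ∀ n i k i' k', u n i k * u n i' k' = if k = i' then u n i k' else 0)
    (hu1 : ∀ n, ∑ i, u n i i = 1) {S : Set C} (hS : Dense S)
    (huc : ∀ x ∈ S, ∀ᶠ n in atTop, ∀ i k, u n i k * x = x * u n i k) :
    ∃ (T : Type v) (l : Filter T) (e : T → ι → ι → B), l.NeBot ∧ CentralMatrixUnits l e := by
  obtain ⟨lA, hlA, hunit⟩ := exists_approximateUnit A
  have hbound : ∀ x a, ‖j (x ⊗ₜ a)‖ ≤ ‖x‖ * ‖a‖ := norm_tensorHom_tmul_le j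
  let T := ℕ × {h : A // star h = h ∧ ‖h‖ ≤ 1}
  let l : Filter T := atTop ×ˢ lA
  let e : T → ι → ι → B := fun t i k => j (u t.1 i k ⊗ₜ t.2.1)
  have he : ∀ t i k, ‖e t i k‖ ≤ 1 := fun t i k => (hbound _ _).trans <|
    mul_le_one₀ (hub _ _ _) (norm_nonneg _) t.2.2.2
  have hmul : ∀ (t : T) i k (x : C) (a : A),
      e t i k * j (x ⊗ₜ a) = j ((u t.1 i k * x) ⊗ₜ (t.2.1 * a)) := by
    intro t i k x a
    rw [← map_mul, Algebra.TensorProduct.tmul_mul_tmul]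
  have hmul' : ∀ (t : T) i k (x : C) (a : A),
      j (x ⊗ₜ a) * e t i k = j ((x * u t.1 i k) ⊗ₜ (a * t.2.1)) := by
    intro t i k x a
    rw [← map_mul, Algebra.TensorProduct.tmul_mul_tmul]
  have hlim : ∀ (y : T → C) (K : ℝ) (b : T → A), (∀ t, ‖y t‖ ≤ K) →
      Tendsto b l (𝓝 0) → Tendsto (fun t : T => j (y t ⊗ₜ b t)) l (𝓝 0) := by
    intro y K b hy hb
    have h1 : Tendsto (fun t : T => K * ‖b t‖) l (𝓝 0) := by
      simpa using hb.norm.const_mul K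
    exact squeeze_zero_norm (fun t => (hbound _ _).trans
      (mul_le_mul_of_nonneg_right (hy t) (norm_nonneg _))) h1
  have hl1 : ∀ a : A, Tendsto (fun t : T => t.2.1 * a) l (𝓝 a) :=
    fun a => (hunit a).1.comp tendsto_snd
  have hl2 : ∀ a : A, Tendsto (fun t : T => a * t.2.1) l (𝓝 a) :=
    fun a => (hunit a).2.comp tendsto_snd
  have hdense : ∀ (K : ℝ) (Φ : T → B →+ B), (∀ t b, ‖Φ t b‖ ≤ K * ‖b‖) →
      (∀ (x : C) (a : A), Tendsto (fun t => Φ t (j (x ⊗ₜ a))) l (𝓝 0)) →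
      ∀ b, Tendsto (fun t => Φ t b) l (𝓝 0) := by
    intro K Φ hΦ h b
    refine tendsto_zero_of_dense Φ K hΦ hj ?_ b
    rintro _ ⟨z, rfl⟩
    induction z using TensorProduct.induction_on with
    | zero => simp
    | tmul x a => exact h x a
    | add y z hy hz => simpa using hy.add hz
  have hle : ∀ t i k b, ‖e t i k * b‖ ≤ ‖b‖ := fun t i k b =>
    (norm_mul_le _ _).trans (mul_le_of_le_one_left (norm_nonneg _) (he _ _ _))
  have hle' : ∀ t i k b, ‖b * e t i k‖ ≤ ‖b‖ := fun t i k b =>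
    (norm_mul_le _ _).trans (mul_le_of_le_one_right (norm_nonneg _) (he _ _ _))
  refine ⟨T, l, e, inferInstance, he, fun t i k => ?_, fun i k => ?_,
    fun i k i' k' => ?_, ?_⟩
  · rw [← map_star, TensorProduct.star_tmul, t.2.2.1, hus]
  · refine hdense 2 (fun t => AddMonoidHom.mulLeft (e t i k) - AddMonoidHom.mulRight (e t i k))
      (fun t b => ?_) fun x a => ?_
    · refine (norm_sub_le _ _).trans ?_
      have h1 := hle t i k b
      have h2 := hle' t i k b
      simp only [AddMonoidHom.coe_mulLeft, AddMonoidHom.coe_mulRight]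
      linarith
    · let Ψ : T → C →+ B := fun t =>
        { toFun := fun y => e t i k * j (y ⊗ₜ a) - j (y ⊗ₜ a) * e t i k
          map_zero' := by simp
          map_add' := fun y z => by
            rw [TensorProduct.add_tmul, map_add, mul_add, add_mul]
            abel }
      refine tendsto_zero_of_dense Ψ (2 * ‖a‖) (fun t y => ?_) hS (fun y hy => ?_) x
      · refine (norm_sub_le _ _).trans ?_
        have h1 := (hle t i k _).trans (hbound y a)
        have h2 := (hle' t i k _).trans (hbound y a)
        linarith
      · have h1 := hlim (fun t => u t.1 i k * y) ‖y‖ (fun t => t.2.1 * a - a * t.2.1)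
          (fun t => (norm_mul_le _ _).trans (mul_le_of_le_one_left (norm_nonneg _) (hub _ _ _)))
          (by simpa using (hl1 a).sub (hl2 a))
        refine h1.congr' ?_
        filter_upwards [(huc y hy).prod_inl lA] with t ht
        change _ = e t i k * j (y ⊗ₜ a) - j (y ⊗ₜ a) * e t i k
        rw [hmul, hmul', ← ht, TensorProduct.tmul_sub, map_sub]
  · have hΦ := hdense 2 (fun t => (AddMonoidHom.mulLeft (e t i k)).comp
      (AddMonoidHom.mulLeft (e t i' k')) - if k = i' then AddMonoidHom.mulLeft (e t i k') else 0)
      (fun t b => ?_) fun x a => ?_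
    · intro b
      refine (hΦ b).congr fun t => ?_
      split_ifs <;> rfl
    · refine (norm_sub_le _ _).trans ?_
      have h1 : ‖e t i k * (e t i' k' * b)‖ ≤ ‖b‖ := (hle _ _ _ _).trans (hle _ _ _ _)
      have h2 : ‖(if k = i' then AddMonoidHom.mulLeft (e t i k') else 0 : B →+ B) b‖ ≤ ‖b‖ := by
        split_ifs
        · exact hle _ _ _ _
        · simp
      change ‖e t i k * (e t i' k' * b)‖ + _ ≤ _
      linarith
    -- A product of two matrix units has h² where a single one has h; the difference disappears in
    -- the limit.
    · have hh : Tendsto (fun t : T => t.2.1 * (t.2.1 * a) - t.2.1 * a) l (𝓝 0) := by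
        have h1 : Tendsto (fun t : T => ‖t.2.1 * a - a‖) l (𝓝 0) := by
          simpa using ((hl1 a).sub_const a).norm
        refine squeeze_zero_norm (fun t => ?_) h1
        rw [← mul_sub]
        exact (norm_mul_le _ _).trans (mul_le_of_le_one_left (norm_nonneg _) t.2.2.2)
      by_cases hk : k = i'
      · have h1 := hlim (fun t => u t.1 i k' * x) ‖x‖ _
          (fun t => (norm_mul_le _ _).trans (mul_le_of_le_one_left (norm_nonneg _) (hub _ _ _))) hh
        refine h1.congr fun t => ?_
        simp only [hk, if_true]
        change _ = e t i i' * (e t i' k' * j (x ⊗ₜ a)) - e t i k' * j (x ⊗ₜ a)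
        rw [hmul, hmul, hmul, ← mul_assoc (u _ _ _), hum, if_pos rfl, TensorProduct.tmul_sub, map_sub]
      · refine tendsto_const_nhds.congr fun t => ?_
        simp only [hk, if_false, sub_zero]
        change _ = e t i k * (e t i' k' * j (x ⊗ₜ a))
        rw [hmul, hmul, ← mul_assoc, hum, if_neg hk]
        simp
  · have hΦ := hdense (Fintype.card ι + 1) (fun t => (∑ i, AddMonoidHom.mulLeft (e t i i)) -
      AddMonoidHom.id B) (fun t b => ?_) fun x a => ?_
    · intro b
      refine (hΦ b).congr fun t => ?_
      simp
    · have h1 : ‖∑ i, e t i i * b‖ ≤ ∑ _i : ι, ‖b‖ := norm_sum_le_of_le _ fun i _ => hle _ _ _ _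
      have h2 := norm_sub_le (∑ i, e t i i * b) b
      simp only [Finset.sum_const, nsmul_eq_mul, Finset.card_univ] at h1
      simp only [AddMonoidHom.sub_apply, AddMonoidHom.finsetSum_apply, AddMonoidHom.coe_mulLeft,
        AddMonoidHom.id_apply]
      linarith
    · have h1 := hlim (fun _ => x) ‖x‖ (fun t => t.2.1 * a - a) (fun _ => le_rfl)
        (by simpa using (hl1 a).sub_const a)
      refine h1.congr fun t => ?_
      simp only [AddMonoidHom.sub_apply, AddMonoidHom.finsetSum_apply, AddMonoidHom.coe_mulLeft,
        AddMonoidHom.id_apply, hmul]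
      rw [← map_sum, ← TensorProduct.sum_tmul, ← Finset.sum_mul, hu1, one_mul,
        TensorProduct.tmul_sub, map_sub]

theorem exists_centralMatrixUnits {q : ℕ} {A : Type v} [NonUnitalCStarAlgebra A]
    (h : TensorAbsorbs (UHF q) A) {ι : Type*} [Fintype ι] [DecidableEq ι] (σ : ι ≃ Fin q) :
    ∃ (T : Type v) (l : Filter T) (e : T → ι → ι → A), l.NeBot ∧ CentralMatrixUnits l e := by
  obtain ⟨B, _, j, ⟨-, hj⟩, ⟨φ⟩⟩ := h
  obtain ⟨T, l, e, hl, he⟩ := exists_centralMatrixUnits_of_tensor j hj (uhfUnit q)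
    (fun n i k => norm_siteMatrixUnit_le n i k)
    (fun n i k => Subtype.ext (star_siteMatrixUnit n i k))
    (fun n i k i' k' => by
      apply Subtype.ext
      have h := siteMatrixUnit_mul n i k i' k'
      split_ifs with hk <;> simpa [uhfUnit, hk] using h)
    (fun n => by
      apply Subtype.ext
      simpa [uhfUnit] using sum_siteMatrixUnit (q := q) n)
    dense_adjoin_siteMatrixUnit
    (fun x hx => (eventually_uhfUnit_commute hx).mono fun n h i k => Subtype.ext (h i k))
  exact ⟨T, l, _, hl, he.map φ.symm σ⟩

end CentralMatrixUnits

/-! ### Unitaries conjugating one system of matrix units into another. -/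

section Conjugators

variable {I E ι : Type*} [CStarAlgebra E] [Fintype ι] [DecidableEq ι]

theorem bstar_sum {κ : Type*} (F : Finset κ) (x : κ → BddFun I E) :
    bstar (∑ k ∈ F, x k) = ∑ k ∈ F, bstar (x k) :=
  map_sum (⟨⟨bstar, Subtype.ext <| funext fun _ => star_zero _⟩, bstar_add⟩ :
    BddFun I E →+ BddFun I E) x F

theorem exists_unitaryFun_flip {L : Filter I} {X : Set (BddFun I E)} (hX : ∀ x ∈ X, bstar x ∈ X)
    {e f : ι → ι → BddFun I E}
    (he : RelMatUnits (cls L '' X) fun i j => cls L (e i j))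
    (hf : RelMatUnits (cls L '' X) fun i j => cls L (f i j))
    (hes : ∀ i j, bstar (e i j) = e j i) (hfs : ∀ i j, bstar (f i j) = f j i)
    (hc : ∀ i j k l, cls L (e i j) * cls L (f k l) = cls L (f k l) * cls L (e i j)) :
    ∃ u : I → unitary E, ∀ x ∈ X,
      cls L (unitaryFun u) * cls L x = cls L x * cls L (unitaryFun u) ∧
      ∀ k, cls L (unitaryFun u) * (cls L (f k k) * cls L x) =
        cls L (e k k) * (cls L (unitaryFun u) * cls L x) := by
  have hs : cls L (flipElt e f) = flipElt (fun i j => cls L (e i j)) fun i j => cls L (f i j) := by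
    simp [flipElt]
  have hstar : cls L (bstar (flipElt e f)) = cls L (flipElt e f) := by
    rw [hs]
    simp only [flipElt, bstar_sum, bstar_mul, hes, hfs, map_sum, map_mul, hc]
    exact Finset.sum_comm
  obtain ⟨u, hu⟩ := exists_unitaryFun_symmetry (flipElt e f) hstar hX
    (fun x hx => by rw [hs]; exact flipElt_mul_self he hf hc ⟨x, hx, rfl⟩)
    (fun x hx => by rw [hs]; exact flipElt_comm he hf ⟨x, hx, rfl⟩)
  refine ⟨u, fun x hx => ⟨(hu x hx).2, fun k => ?_⟩⟩
  have hx' : cls L x ∈ cls L '' X := ⟨x, hx, rfl⟩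
  have h1 := flipElt_conj he hf hc hx' k k
  -- The unitary may be replaced by the flip only directly in front of x, so f_{kk} is moved to the
  -- right of x.
  rw [(hu x hx).1, hs, ← h1, hf.comm _ _ _ hx', ← mul_assoc, (hu x hx).1, hs, mul_assoc]

/-- The systems e and f need not commute with each other, which rules out a direct flip. Each
commutes with c, so f is flipped into c and then c into e. -/
theorem exists_unitaryFun_conj {L : Filter I} {X : Set (BddFun I E)} (hX : ∀ x ∈ X, bstar x ∈ X)
    {e f c : ι → ι → BddFun I E}
    (he : RelMatUnits (cls L '' X) fun i j => cls L (e i j))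
    (hf : RelMatUnits (cls L '' X) fun i j => cls L (f i j))
    (hc : RelMatUnits (cls L '' X) fun i j => cls L (c i j))
    (hes : ∀ i j, bstar (e i j) = e j i) (hfs : ∀ i j, bstar (f i j) = f j i)
    (hcs : ∀ i j, bstar (c i j) = c j i)
    (hce : ∀ i j k l, cls L (c i j) * cls L (e k l) = cls L (e k l) * cls L (c i j))
    (hcf : ∀ i j k l, cls L (c i j) * cls L (f k l) = cls L (f k l) * cls L (c i j)) :
    ∃ u : I → unitary E, ∀ x ∈ X,
      cls L (unitaryFun u) * cls L x = cls L x * cls L (unitaryFun u) ∧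
      ∀ k, cls L (unitaryFun u) * (cls L (f k k) * cls L x) =
        cls L (e k k) * (cls L (unitaryFun u) * cls L x) := by
  obtain ⟨u, hu⟩ := exists_unitaryFun_flip hX hc hf hcs hfs hcf
  obtain ⟨w, hw⟩ := exists_unitaryFun_flip hX he hc hes hcs fun i j k l => (hce k l i j).symm
  have huw : cls L (unitaryFun fun i => w i * u i) =
      cls L (unitaryFun w) * cls L (unitaryFun u) := by
    rw [← map_mul]
    rfl
  refine ⟨fun i => w i * u i, fun x hx => ⟨?_, fun k => ?_⟩⟩
  · rw [huw, mul_assoc, (hu x hx).1, ← mul_assoc, (hw x hx).1, mul_assoc]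
  · rw [huw, mul_assoc, (hu x hx).2, (hu x hx).1, ← mul_assoc (cls L (c k k)), ← mul_assoc,
      (hw x hx).2]
    simp only [mul_assoc]
    rw [(hu x hx).1]

end Conjugators

/-! ### Elements that are diagonal in a system of matrix units. -/

section DiagonalUnitary

variable {Q ι : Type*} [Ring Q] [Fintype ι] [DecidableEq ι] {X : Set Q} {e : ι → ι → Q}

/-- The form 1 + Σ e_{ii} b_i is used in place of Σ e_{ii}(1 + b_i), because Σ e_{ii} acts as the
unit only on X. -/
theorem RelMatUnits.diag_mul (he : RelMatUnits X e) {b : ι → Q} (hb : ∀ i, b i ∈ X) (k : ι)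
    (z : Q) :
    (1 + ∑ i, e i i * b i) * (e k k * z) = e k k * ((1 + b k) * z) := by
  have h : ∀ i, e i i * b i * (e k k * z) = if i = k then e i i * (b i * z) else 0 := by
    intro i
    rw [← mul_assoc, mul_assoc (e i i), ← he.comm _ _ _ (hb i), he.mul _ _ _ _ _ (hb i)]
    split_ifs with hik
    · rw [hik, mul_assoc]
    · simp
  rw [add_mul, Finset.sum_mul, one_mul]
  simp [h]
  noncomm_ring

theorem RelMatUnits.mul_diag (he : RelMatUnits X e) {b : ι → Q} (hb : ∀ i, b i ∈ X) (k : ι)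
    {z : Q} (hz : e k k * z = z * e k k) :
    (e k k * z) * (1 + ∑ i, b i * e i i) = e k k * (z * (1 + b k)) := by
  have h : ∀ i, e k k * z * (b i * e i i) = if k = i then e k k * (z * b k) else 0 := by
    intro i
    rw [← he.comm _ _ _ (hb i), hz, mul_assoc, he.mul _ _ _ _ _ (hb i)]
    split_ifs with hik
    · rw [← hik, ← mul_assoc, ← hz, mul_assoc]
    · simp
  rw [mul_add, Finset.mul_sum, mul_one]
  simp [h]
  noncomm_ring

theorem RelMatUnits.diag_mul_diag (he : RelMatUnits X e) {b c : ι → Q} (hb : ∀ i, b i ∈ X)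
    (hc : ∀ i, c i ∈ X) (hbc : ∀ i, (1 + b i) * (1 + c i) = 1) :
    (1 + ∑ i, e i i * b i) * (1 + ∑ i, c i * e i i) = 1 := by
  have h : ∀ k, (1 + ∑ i, e i i * b i) * (c k * e k k) = - (e k k * b k) := by
    intro k
    rw [← he.comm _ _ _ (hc k), he.diag_mul hb k]
    have h1 : (1 + b k) * c k = - b k := by
      have := hbc k
      rw [mul_add, mul_one, add_assoc, add_eq_left] at this
      exact eq_neg_of_add_eq_zero_right this
    rw [h1, mul_neg]
  rw [mul_add, mul_one, Finset.mul_sum]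
  simp [h]

theorem RelMatUnits.mul_diag_diag (he : RelMatUnits X e) {b c : ι → Q} (hb : ∀ i, b i ∈ X)
    (hc : ∀ i, c i ∈ X) (hbc : ∀ i, (1 + c i) * (1 + b i) = 1) :
    (1 + ∑ i, c i * e i i) * (1 + ∑ i, e i i * b i) = 1 := by
  have := he.diag_mul_diag hc hb hbc
  simpa only [he.comm _ _ _ (hb _), he.comm _ _ _ (hc _)] using this

end DiagonalUnitary

/-! ### Iterated limits and the relative matrix units they produce. -/

section BaseFunctions

variable {A I J T ι : Type*} [NonUnitalCStarAlgebra A]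

/-- Bounded functions with values in `A` that factor through `p`. -/
def baseSet (A : Type*) [NonUnitalCStarAlgebra A] (p : I → J) :
    Set (BddFun I (Unitization ℂ A)) :=
  {x | ∃ a : J → A, ∀ i, x.1 i = (a (p i) : Unitization ℂ A)}

theorem bstar_mem_baseSet {p : I → J} {x : BddFun I (Unitization ℂ A)} (hx : x ∈ baseSet A p) :
    bstar x ∈ baseSet A p := by
  obtain ⟨a, ha⟩ := hx
  exact ⟨fun j => star (a j), fun i => by simp [bstar, ha]⟩

/-- A family of elements of norm at most one as a bounded function. -/
def boundedFun (a : I → A) (C : ℝ) (h : ∀ i, ‖a i‖ ≤ C) : BddFun I (Unitization ℂ A) :=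
  ⟨fun i => a i, C, fun i => by rw [Unitization.norm_inr]; exact h i⟩

theorem boundedFun_mem_baseSet {p : I → J} (a : J → A) (C : ℝ) (h : ∀ i, ‖a (p i)‖ ≤ C) :
    boundedFun (fun i => a (p i)) C h ∈ baseSet A p :=
  ⟨a, fun _ => rfl⟩

/-- Along `L`, the `T`-coordinate `τ` tends to `l` for the `J`-coordinate `p` held fixed. -/
def IsGeneric (p : I → J) (τ : I → T) (l : Filter T) (L : Filter I) : Prop :=
  ∀ P : J → T → Prop, (∀ j, ∀ᶠ t in l, P j t) → ∀ᶠ i in L, P (p i) (τ i)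

theorem IsGeneric.tendsto {B : Type*} [SeminormedAddCommGroup B] {p : I → J} {τ : I → T}
    {l : Filter T} {L : Filter I} (h : IsGeneric p τ l L) {F : J → T → B}
    (hF : ∀ j, Tendsto (F j) l (𝓝 0)) : Tendsto (fun i => F (p i) (τ i)) L (𝓝 0) := by
  rw [Metric.tendsto_nhds]
  intro ε hε
  exact h (fun j t => dist (F j t) 0 < ε) fun j => Metric.tendsto_nhds.1 (hF j) ε hε

theorem tendsto_inr {L : Filter I} {f : I → A} (h : Tendsto f L (𝓝 0)) :
    Tendsto (fun i => (f i : Unitization ℂ A)) L (𝓝 0) :=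
  squeeze_zero_norm (fun i => (Unitization.norm_inr (𝕜 := ℂ) (f i)).le) (by simpa using h.norm)

variable [Fintype ι] [DecidableEq ι]

/-- Each relation is a limit along l for one fixed a in A. Genericity allows a to vary with the
coordinate p, since l is taken to its limit with p held fixed. -/
theorem CentralMatrixUnits.relMatUnits {l : Filter T} {e : T → ι → ι → A}
    (he : CentralMatrixUnits l e) {p : I → J} {τ : I → T} {L : Filter I}
    (h : IsGeneric p τ l L) :
    RelMatUnits (cls L '' baseSet A p) fun i j =>
      cls L (boundedFun (fun s => e (τ s) i j) 1 fun _ => he.norm_le _ _ _) := by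
  refine ⟨?_, ?_, ?_⟩
  · rintro i j _ ⟨x, ⟨a, ha⟩, rfl⟩
    rw [← map_mul, ← map_mul, cls_eq_iff]
    refine (tendsto_inr (h.tendsto fun s => he.comm i j (a s))).congr fun s => ?_
    simp [boundedFun, ha]
  · rintro i j k m _ ⟨x, ⟨a, ha⟩, rfl⟩
    have h1 := tendsto_inr (h.tendsto fun s => he.mul i j k m (a s))
    rw [← map_mul, ← map_mul]
    split_ifs with hjk
    · rw [← map_mul, cls_eq_iff]
      refine h1.congr fun s => ?_
      simp [boundedFun, ha, hjk]
    · rw [cls_eq_zero_iff]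
      refine h1.congr fun s => ?_
      simp [boundedFun, ha, hjk]
  · rintro _ ⟨x, ⟨a, ha⟩, rfl⟩
    simp only [← map_mul, ← map_sum]
    rw [cls_eq_iff]
    refine (tendsto_inr (h.tendsto fun s => he.one (a s))).congr fun s => ?_
    have h2 : (∑ i, boundedFun (fun s => e (τ s) i i) 1 (fun _ => he.norm_le _ _ _) * x).1 s =
        ∑ i, (e (τ s) i i : Unitization ℂ A) * x.1 s := by
      rw [AddSubmonoidClass.coe_finsetSum, Finset.sum_apply]
      rfl
    rw [h2, ha]
    have h3 : ∀ f : ι → A, ((∑ i, f i : A) : Unitization ℂ A) = ∑ i, (f i : Unitization ℂ A) :=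
      fun f => map_sum (Unitization.inrHom ℂ ℂ A) f _
    simp [h3]

theorem CentralMatrixUnits.comm_base {l : Filter T} {e : T → ι → ι → A}
    (he : CentralMatrixUnits l e) {p : I → J} {τ : I → T} {L : Filter I}
    (h : IsGeneric p τ l L) (i j : ι) {x : BddFun I (Unitization ℂ A)} (hx : x ∈ baseSet A p) :
    cls L (boundedFun (fun s => e (τ s) i j) 1 fun _ => he.norm_le _ _ _) * cls L x =
      cls L x * cls L (boundedFun (fun s => e (τ s) i j) 1 fun _ => he.norm_le _ _ _) :=
  (he.relMatUnits h).comm i j _ ⟨x, hx, rfl⟩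

end BaseFunctions

/-! ### Inner automorphisms and normalised implementing unitaries. -/

section ConjugationAutomorphism

variable {A : Type*} [NonUnitalCStarAlgebra A]

/-- Conjugation by a unitary of the unitization, as a function. -/
def conjFun (u : unitary (Unitization ℂ A)) (a : A) : A :=
  ((u : Unitization ℂ A) * a * star (u : Unitization ℂ A)).snd

theorem inr_conjFun (u : unitary (Unitization ℂ A)) (a : A) :
    ((conjFun u a : A) : Unitization ℂ A) =
      (u : Unitization ℂ A) * a * star (u : Unitization ℂ A) := by
  apply Unitization.ext
  · simp
  · rfl

theorem conjFun_star_conjFun (u : unitary (Unitization ℂ A)) (a : A) :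
    conjFun (star u) (conjFun u a) = a := by
  apply Unitization.inr_injective (R := ℂ)
  rw [inr_conjFun, inr_conjFun]
  simp [mul_assoc, ← mul_assoc (star (u : Unitization ℂ A)) (u : Unitization ℂ A)]

/-- Conjugation by a unitary of the unitization. -/
def conjAut (u : unitary (Unitization ℂ A)) : A ≃⋆ₐ[ℂ] A where
  toFun := conjFun u
  invFun := conjFun (star u)
  left_inv := conjFun_star_conjFun u
  right_inv a := by
    have h := conjFun_star_conjFun (star u) a
    rwa [star_star] at h
  map_add' a b := by simp [conjFun, mul_add, add_mul]
  map_smul' c a := by simp [conjFun]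
  map_star' a := by
    apply Unitization.inr_injective (R := ℂ)
    rw [Unitization.inr_star, inr_conjFun, inr_conjFun]
    simp [mul_assoc]
  map_mul' a b := by
    apply Unitization.inr_injective (R := ℂ)
    rw [Unitization.inr_mul, inr_conjFun, inr_conjFun, inr_conjFun]
    simp [mul_assoc, ← mul_assoc (star (u : Unitization ℂ A)) (u : Unitization ℂ A)]

theorem inr_conjAut (u : unitary (Unitization ℂ A)) (a : A) :
    ((conjAut u a : A) : Unitization ℂ A) =
      (u : Unitization ℂ A) * a * star (u : Unitization ℂ A) :=
  inr_conjFun u a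

/-- The extension of an automorphism to the unitization. -/
abbrev unitizationHom (β : A ≃⋆ₐ[ℂ] A) : Unitization ℂ A →⋆ₐ[ℂ] Unitization ℂ A :=
  Unitization.starMap (β : A →⋆ₙₐ[ℂ] A)

theorem unitizationHom_inr (β : A ≃⋆ₐ[ℂ] A) (a : A) :
    unitizationHom β (a : Unitization ℂ A) = (β a : Unitization ℂ A) :=
  Unitization.starMap_inr _ _

theorem fst_unitizationHom (β : A ≃⋆ₐ[ℂ] A) (x : Unitization ℂ A) :
    (unitizationHom β x).fst = x.fst := by
  induction x with
  | inl_add_inr r a =>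
    rw [map_add, unitizationHom_inr, Unitization.starMap_inl]
    simp [Unitization.algebraMap_eq_inl]

theorem norm_unitizationHom_le (β : A ≃⋆ₐ[ℂ] A) (x : Unitization ℂ A) :
    ‖unitizationHom β x‖ ≤ ‖x‖ :=
  NonUnitalStarAlgHom.norm_apply_le (unitizationHom β) x

/-- The unitaries implementing an approximate unitary equivalence can be chosen with scalar
part one. -/
theorem ApproxUnitarilyEquiv.exists_fst_eq_one {B : Type*} [NonUnitalCStarAlgebra B]
    {φ ψ : B →⋆ₙₐ[ℂ] A} (h : ApproxUnitarilyEquiv φ ψ) :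
    ∃ u : ℕ → unitary (Unitization ℂ A), (∀ n, (u n : Unitization ℂ A).fst = 1) ∧
      ∀ a : B, Tendsto (fun n => (u n : Unitization ℂ A) * (φ a : Unitization ℂ A) *
        star (u n : Unitization ℂ A)) atTop (𝓝 (ψ a : Unitization ℂ A)) := by
  obtain ⟨u, hu⟩ := h
  have hz : ∀ n, star (u n : Unitization ℂ A).fst * (u n : Unitization ℂ A).fst = 1 := by
    intro n
    rw [← Unitization.fst_star, ← Unitization.fst_mul, Unitary.star_mul_self_of_mem (u n).2,
      Unitization.fst_one]
  have hz' : ∀ n, (u n : Unitization ℂ A).fst * star (u n : Unitization ℂ A).fst = 1 :=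
    fun n => by rw [mul_comm, hz]
  -- Multiplication by the conjugate of the scalar part, a number of modulus one, leaves the
  -- conjugation unchanged and puts u - 1 into A.
  refine ⟨fun n => ⟨star (u n : Unitization ℂ A).fst • (u n : Unitization ℂ A), ?_⟩,
    fun n => ?_, fun a => (hu a).congr fun n => ?_⟩
  · rw [Unitary.mem_iff]
    constructor
    · rw [star_smul, smul_mul_smul_comm, star_star, hz', Unitary.star_mul_self_of_mem (u n).2,
        one_smul]
    · rw [star_smul, smul_mul_smul_comm, star_star, hz, Unitary.mul_star_self_of_mem (u n).2,
        one_smul]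
  · simpa using hz n
  · simp only [star_smul, star_star, smul_mul_assoc, mul_smul_comm, smul_smul]
    rw [hz', one_smul]

end ConjugationAutomorphism

/-! ### A net of unitaries making β exactly multiplicative in the limit. -/

section RokhlinNet

variable {A : Type*} [NonUnitalCStarAlgebra A] {I : Type*}

/-- Pointwise application of an automorphism to bounded functions. -/
def autFun (β : A ≃⋆ₐ[ℂ] A) :
    BddFun I (Unitization ℂ A) →+* BddFun I (Unitization ℂ A) where
  toFun x := ⟨fun i => unitizationHom β (x.1 i), x.2.imp fun _ h i =>
    (norm_unitizationHom_le β _).trans (h i)⟩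
  map_one' := Subtype.ext <| funext fun _ => map_one _
  map_zero' := Subtype.ext <| funext fun _ => map_zero _
  map_mul' _ _ := Subtype.ext <| funext fun _ => map_mul _ _ _
  map_add' _ _ := Subtype.ext <| funext fun _ => map_add _ _ _

/-- The endomorphism of the sequence quotient induced by an automorphism. -/
def autQuot (L : Filter I) (β : A ≃⋆ₐ[ℂ] A) :
    SeqQuot L (Unitization ℂ A) →+* SeqQuot L (Unitization ℂ A) :=
  Ideal.Quotient.lift (nullIdeal L _) ((cls L).comp (autFun β)) fun x hx =>
    cls_eq_zero_iff.2 <| squeeze_zero_norm (fun _ => norm_unitizationHom_le β _)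
      (by simpa using (show Tendsto x.1 L (𝓝 0) from hx).norm)

theorem autQuot_cls (L : Filter I) (β : A ≃⋆ₐ[ℂ] A) (x : BddFun I (Unitization ℂ A)) :
    autQuot L β (cls L x) = cls L (autFun β x) := rfl

/-- Constant functions. -/
def constFun (I : Type*) (a : A) : BddFun I (Unitization ℂ A) :=
  boundedFun (fun _ => a) ‖a‖ fun _ => le_rfl

theorem constFun_mem_baseSet {J : Type*} (p : I → J) (a : A) : constFun I a ∈ baseSet A p :=
  ⟨fun _ => a, fun _ => rfl⟩

theorem autFun_constFun (β : A ≃⋆ₐ[ℂ] A) (a : A) :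
    autFun β (constFun I a) = constFun I (β a) :=
  Subtype.ext <| funext fun _ => unitizationHom_inr β a

theorem autFun_boundedFun (β : A ≃⋆ₐ[ℂ] A) (a : I → A) (C : ℝ) (h : ∀ i, ‖a i‖ ≤ C)
    (h' : ∀ i, ‖β (a i)‖ ≤ C) :
    autFun β (boundedFun a C h) = boundedFun (fun i => β (a i)) C h' :=
  Subtype.ext <| funext fun i => unitizationHom_inr β (a i)

theorem one_add_snd {w : Unitization ℂ A} (hw : w.fst = 1) :
    1 + (w.snd : Unitization ℂ A) = w := by
  apply Unitization.ext <;> simp [hw]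

theorem norm_snd_unitary_le (w : unitary (Unitization ℂ A))
    (hw : (w : Unitization ℂ A).fst = 1) : ‖(w : Unitization ℂ A).snd‖ ≤ 2 := by
  rw [← Unitization.norm_inr (𝕜 := ℂ), eq_sub_of_add_eq' (one_add_snd hw)]
  refine (norm_sub_le _ _).trans ?_
  simp
  norm_num

theorem neBot_curry {J T : Type*} (k : Filter J) (l : Filter T) [hk : k.NeBot] [hl : l.NeBot] :
    (k.curry l).NeBot := by
  rw [neBot_iff, Ne, ← eventually_false_iff_eq_bot, eventually_curry_iff]
  simp [hk.ne, hl.ne]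

variable {G : Type*} [Group G]

/-- Unitaries relating `β` to `β` twisted by itself. -/
theorem exists_unitary_twist {β : G → (A ≃⋆ₐ[ℂ] A)}
    (hβ : ∀ g h : G, ApproxUnitarilyEquiv
      ((β g * β h : A ≃⋆ₐ[ℂ] A) : A →⋆ₙₐ[ℂ] A) (β (g * h) : A →⋆ₙₐ[ℂ] A)) (g m : G) :
    ∃ w : ℕ → unitary (Unitization ℂ A), (∀ n, (w n : Unitization ℂ A).fst = 1) ∧
      ∀ a : A, Tendsto (fun n => (w n : Unitization ℂ A) * (β g a : Unitization ℂ A) *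
        star (w n : Unitization ℂ A)) atTop
          (𝓝 (((β m).symm (β (m * g) a) : A) : Unitization ℂ A)) := by
  obtain ⟨u, hu1, hu⟩ := (hβ m g).exists_fst_eq_one
  -- The unitaries that take β_mβ_g to β_{mg} are pulled back by β_m⁻¹.
  refine ⟨fun n => ⟨unitizationHom (β m).symm (u n), Unitary.map_mem _ (u n).2⟩,
    fun n => (fst_unitizationHom _ _).trans (hu1 n), fun a => ?_⟩
  have h := hu a
  rw [tendsto_iff_norm_sub_tendsto_zero] at h ⊢
  refine squeeze_zero (fun _ => norm_nonneg _) (fun n => ?_) h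
  refine le_trans (le_of_eq ?_) (norm_unitizationHom_le (β m).symm _)
  have h1 : (((β m * β g : A ≃⋆ₐ[ℂ] A) : A →⋆ₙₐ[ℂ] A) a) = β m (β g a) := rfl
  have h2 : ((β (m * g) : A →⋆ₙₐ[ℂ] A) a) = β (m * g) a := rfl
  rw [map_sub, map_mul, map_mul, map_star, h1, h2, unitizationHom_inr, unitizationHom_inr,
    StarAlgEquiv.symm_apply_apply]

variable [Fintype G] [DecidableEq G]

/-- Since every 1 + b_m is unitary, the diagonal element is unitary modulo null functions, and polar
decomposition replaces it by genuine unitaries. -/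
theorem exists_unitaryFun_diag {ι E : Type*} [Fintype ι] [DecidableEq ι] [CStarAlgebra E] {L : Filter I} {X : Set (BddFun I E)}
    (hX : ∀ x ∈ X, bstar x ∈ X) {e : ι → ι → BddFun I E}
    (he : RelMatUnits (cls L '' X) fun i j => cls L (e i j)) (hes : ∀ i j, bstar (e i j) = e j i)
    {b : ι → BddFun I E} (hb : ∀ m, b m ∈ X) {w : ι → I → unitary E}
    (hbw : ∀ m, 1 + b m = unitaryFun (w m)) :
    ∃ u : I → unitary E, cls L (unitaryFun u) = 1 + ∑ m, cls L (e m m) * cls L (b m) ∧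
      cls L (bstar (unitaryFun u)) = 1 + ∑ m, cls L (bstar (b m)) * cls L (e m m) := by
  have hb₁ : ∀ m, cls L (b m) ∈ cls L '' X := fun m => ⟨_, hb m, rfl⟩
  have hb₂ : ∀ m, cls L (bstar (b m)) ∈ cls L '' X := fun m => ⟨_, hX _ (hb m), rfl⟩
  have hbw' : ∀ m, 1 + bstar (b m) = bstar (unitaryFun (w m)) := fun m => by
    rw [← hbw, bstar_add, bstar_one]
  let U : BddFun I E := 1 + ∑ m, e m m * b m
  have hU : cls L U = 1 + ∑ m, cls L (e m m) * cls L (b m) := by simp [U]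
  have hU' : cls L (bstar U) = 1 + ∑ m, cls L (bstar (b m)) * cls L (e m m) := by
    simp [U, bstar_add, bstar_one, bstar_sum, bstar_mul, hes]
  obtain ⟨u, hu⟩ := exists_unitaryFun_cls_eq (L := L) U
    (by
      rw [hU, hU']
      refine he.mul_diag_diag hb₁ hb₂ fun m => ?_
      rw [← map_one (cls L), ← map_add, ← map_add, ← map_mul, hbw, hbw', bstar_mul_unitaryFun])
    (by
      rw [hU, hU']
      refine he.diag_mul_diag hb₁ hb₂ fun m => ?_
      rw [← map_one (cls L), ← map_add, ← map_add, ← map_mul, hbw, hbw', unitaryFun_mul_bstar])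
  exact ⟨u, hu.trans hU, (cls_bstar_congr hu).trans hU'⟩

theorem conj_mul_conj {Q : Type*} [Ring Q] {U U' V V' f e z : Q} (hz : V * z = z * V)
    (hf : V * (f * z) = e * (V * z)) (hV : V * V' = 1) :
    U * V * (f * z) * (V' * U') = U * (e * z) * U' := by
  calc _ = U * (V * (f * z)) * V' * U' := by noncomm_ring
    _ = U * (e * z) * (V * V') * U' := by
      rw [hf, hz]
      noncomm_ring
    _ = _ := by rw [hV, mul_one]

/-- There are three nested limits: n for the unitaries w of the twist, then a T-coordinate for the
system ε, then another for the intermediary c. The order matters: ε must commute with the functions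
of n, and c with those and with ε and β_g(ε). -/
theorem exists_rokhlin_net {T : Type v} {l : Filter T} [l.NeBot] {e : T → G → G → A}
    (he : CentralMatrixUnits l e) {β : G → (A ≃⋆ₐ[ℂ] A)}
    (hβ : ∀ g h : G, ApproxUnitarilyEquiv
      ((β g * β h : A ≃⋆ₐ[ℂ] A) : A →⋆ₙₐ[ℂ] A) (β (g * h) : A →⋆ₙₐ[ℂ] A)) :
    ∃ (I : Type v) (L : Filter I) (_ : L.NeBot) (a : I → G → A) (ha : ∀ i g, ‖a i g‖ ≤ 1)
      (W : G → I → unitary (Unitization ℂ A)) (E : G → SeqQuot L (Unitization ℂ A)),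
      (∀ m, E m = cls L (boundedFun (fun i => a i m) 1 fun i => ha i m)) ∧
      (∀ i g, star (a i g) = a i g) ∧
      (∀ m y, E m * cls L (constFun I y) = cls L (constFun I y) * E m) ∧
      (∀ m n y, E m * (E n * cls L (constFun I y)) =
        if m = n then E m * cls L (constFun I y) else 0) ∧
      (∀ y, ∑ m, E m * cls L (constFun I y) = cls L (constFun I y)) ∧
      ∀ g m y, cls L (unitaryFun (W g)) * autQuot L (β g) (E m * cls L (constFun I y)) *
          cls L (bstar (unitaryFun (W g))) =
        E (m * g⁻¹) * cls L (constFun I ((β (m * g⁻¹)).symm (β m y))) := by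
  let I := (ℕ × T) × T
  let L : Filter I := ((atTop : Filter ℕ).curry l).curry l
  have hL₀ : ((atTop : Filter ℕ).curry l).NeBot := neBot_curry _ _
  have hL : L.NeBot := neBot_curry _ _
  let p₁ : I → ℕ := fun i => i.1.1
  let p₂ : I → ℕ × T := fun i => i.1
  let τ₁ : I → T := fun i => i.1.2
  let τ₂ : I → T := fun i => i.2
  have hgen₁ : IsGeneric p₁ τ₁ l L := by
    intro P hP
    refine eventually_curry_iff.2 (eventually_curry_iff.2 (Eventually.of_forall fun n => ?_))
    exact (hP n).mono fun t ht => Eventually.of_forall fun _ => ht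
  have hgen₂ : IsGeneric p₂ τ₂ l L := by
    intro P hP
    exact eventually_curry_iff.2 (Eventually.of_forall hP)
  have hp₁ : Tendsto p₁ L atTop :=
    (tendsto_fst.mono_left curry_le_prod).comp (tendsto_fst.mono_left curry_le_prod)
  have hbase : baseSet A p₁ ⊆ baseSet A p₂ := by
    rintro x ⟨a, ha⟩
    exact ⟨fun j => a j.1, ha⟩
  let ε : G → G → BddFun I (Unitization ℂ A) := fun i j =>
    boundedFun (fun s => e (τ₁ s) i j) 1 fun _ => he.norm_le _ _ _
  let c : G → G → BddFun I (Unitization ℂ A) := fun i j =>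
    boundedFun (fun s => e (τ₂ s) i j) 1 fun _ => he.norm_le _ _ _
  have hε : RelMatUnits (cls L '' baseSet A p₁) fun i j => cls L (ε i j) := he.relMatUnits hgen₁
  have hc : RelMatUnits (cls L '' baseSet A p₁) fun i j => cls L (c i j) :=
    (he.relMatUnits hgen₂).mono (Set.image_mono hbase)
  have hεs : ∀ i j, bstar (ε i j) = ε j i := fun i j => Subtype.ext <| funext fun s => by
    simp [bstar, ε, boundedFun, ← Unitization.inr_star, he.star_eq]
  have hcs : ∀ i j, bstar (c i j) = c j i := fun i j => Subtype.ext <| funext fun s => by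
    simp [bstar, c, boundedFun, ← Unitization.inr_star, he.star_eq]
  have hεmem : ∀ i j, ε i j ∈ baseSet A p₂ := fun i j =>
    boundedFun_mem_baseSet (p := p₂) (fun s => e s.2 i j) _ _
  have hK : ∀ y : A, cls L (constFun I y) ∈ cls L '' baseSet A p₁ :=
    fun y => ⟨_, constFun_mem_baseSet p₁ y, rfl⟩
  have hmain : ∀ g, ∃ W : I → unitary (Unitization ℂ A), ∀ m y,
      cls L (unitaryFun W) * autQuot L (β g) (cls L (ε m m) * cls L (constFun I y)) *
          cls L (bstar (unitaryFun W)) =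
        cls L (ε (m * g⁻¹) (m * g⁻¹)) *
          cls L (constFun I ((β (m * g⁻¹)).symm (β m y))) := by
    intro g
    have hmap := he.map (β g) (Equiv.refl G)
    have hfe : ∀ i j, autFun (β g) (ε i j) =
        boundedFun (fun s => β g (e (τ₁ s) i j)) 1 fun _ => hmap.norm_le _ _ _ :=
      fun i j => autFun_boundedFun _ _ _ _ _
    have hf : RelMatUnits (cls L '' baseSet A p₁) fun i j => cls L (autFun (β g) (ε i j)) := by
      simp only [hfe]
      exact hmap.relMatUnits hgen₁
    -- Translating the indices of the target system by g⁻¹ makes V carry β_g(ε_{mm}) to the block of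
    -- m g⁻¹.
    obtain ⟨V, hV⟩ := exists_unitaryFun_conj (L := L) (X := baseSet A p₁)
      (fun x hx => bstar_mem_baseSet hx)
      (e := fun i j => ε (i * g⁻¹) (j * g⁻¹)) (f := fun i j => autFun (β g) (ε i j)) (c := c)
      (hε.reindex (Equiv.mulRight g⁻¹)) hf hc (fun i j => hεs _ _)
      (fun i j => by
        rw [← hεs i j]
        exact Subtype.ext <| funext fun s => (map_star _ _).symm) hcs
      (fun i j k m => he.comm_base hgen₂ i j (hεmem _ _))
      (fun i j k m => he.comm_base hgen₂ i j (by
        rw [hfe]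
        exact boundedFun_mem_baseSet (p := p₂) (fun s => β g (e s.2 k m)) _ _))
    -- For k = m g⁻¹ one has kg = m, so the k-th sequence conjugates β_g into β_k⁻¹β_m, as wanted in
    -- the block ε_{kk}.
    choose w hw1 hw using exists_unitary_twist hβ g
    let b : G → BddFun I (Unitization ℂ A) := fun m =>
      boundedFun (fun s => (w m (p₁ s) : Unitization ℂ A).snd) 2
        fun s => norm_snd_unitary_le _ (hw1 _ _)
    have hb : ∀ m, cls L (b m) ∈ cls L '' baseSet A p₁ := fun m =>
      ⟨_, boundedFun_mem_baseSet (p := p₁) (fun n => (w m n : Unitization ℂ A).snd) _ _, rfl⟩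
    have hb' : ∀ m, cls L (bstar (b m)) ∈ cls L '' baseSet A p₁ := fun m =>
      ⟨_, bstar_mem_baseSet
        (boundedFun_mem_baseSet (p := p₁) (fun n => (w m n : Unitization ℂ A).snd) _ _), rfl⟩
    have hbw : ∀ m, 1 + b m = unitaryFun fun s => w m (p₁ s) := fun m =>
      Subtype.ext <| funext fun s => one_add_snd (hw1 _ _)
    have hbw' : ∀ m, 1 + bstar (b m) = bstar (unitaryFun fun s => w m (p₁ s)) := fun m => by
      rw [← hbw, bstar_add, bstar_one]
    obtain ⟨u, hU, hU'⟩ := exists_unitaryFun_diag (fun x hx => bstar_mem_baseSet hx) hε hεs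
      (b := b)
      (fun m => boundedFun_mem_baseSet (p := p₁) (fun n => (w m n : Unitization ℂ A).snd) _ _) hbw
    -- V acts first and moves the m-th block to the k-th; there the diagonal unitary u acts as w_k.
    refine ⟨fun i => u i * V i, fun m y => ?_⟩
    have huV : unitaryFun (fun i => u i * V i) = unitaryFun u * unitaryFun V := rfl
    set k := m * g⁻¹ with hk
    have hz := constFun_mem_baseSet p₁ (β g y)
    set z : BddFun I (Unitization ℂ A) := constFun I (β g y) with hzdef
    have hcomm : cls L (ε k k) * ((1 + cls L (b k)) * cls L z) =
        (1 + cls L (b k)) * cls L z * cls L (ε k k) := by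
      have h1 := hε.comm k k _ (hK (β g y))
      have h2 := hε.comm k k _ (hb k)
      calc _ = cls L (ε k k) * cls L z + (cls L (ε k k) * cls L (b k)) * cls L z := by
            noncomm_ring
        _ = _ := by
            rw [h2, mul_assoc, h1]
            noncomm_ring
    have hlim : (1 + cls L (b k)) * cls L z * (1 + cls L (bstar (b k))) =
        cls L (constFun I ((β k).symm (β m y))) := by
      rw [← map_one (cls L), ← map_add, ← map_add, ← map_mul, ← map_mul, hbw, hbw', cls_eq_iff]
      have h1 := ((hw k y).comp hp₁).sub_const (((β k).symm (β (k * g) y) : A) : Unitization ℂ A)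
      rw [sub_self] at h1
      have h2 : k * g = m := by simp [hk]
      rw [h2] at h1
      exact h1
    rw [map_mul, autQuot_cls, autQuot_cls, autFun_constFun, huV, bstar_mul, map_mul, map_mul,
      conj_mul_conj (hV z hz).1 ((hV z hz).2 m)
        (by rw [← map_mul, unitaryFun_mul_bstar, map_one]),
      hU, hU', hε.diag_mul hb k, hε.mul_diag hb' k hcomm, hlim]
  choose W hW using hmain
  exact ⟨I, L, hL, fun i m => e (τ₁ i) m m, fun i m => he.norm_le _ _ _, W,
    fun m => cls L (ε m m), fun m => rfl, fun i m => he.star_eq _ _ _,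
    fun m y => hε.comm m m _ (hK y), fun m n y => (hε.mul m m n n _ (hK y)).trans (by
      by_cases h : m = n
      · subst h
        rfl
      · rw [if_neg h, if_neg h]),
    fun y => hε.one _ (hK y), hW⟩

end RokhlinNet

/-! ### One correction step with finitely many estimates. -/

section RokhlinStep

variable {A : Type*} [NonUnitalCStarAlgebra A] {I : Type*}

theorem eventually_norm_sub_le {L : Filter I} {x y : BddFun I (Unitization ℂ A)}
    (h : cls L x = cls L y) {f k : I → A} (hx : ∀ i, x.1 i = (f i : Unitization ℂ A))
    (hy : ∀ i, y.1 i = (k i : Unitization ℂ A)) {ε : ℝ} (hε : 0 < ε) :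
    ∀ᶠ i in L, ‖f i - k i‖ ≤ ε := by
  rw [cls_eq_iff] at h
  filter_upwards [(tendsto_zero_iff_norm_tendsto_zero.1 h).eventually_le_const hε] with i hi
  rwa [hx, hy, ← Unitization.inr_sub, Unitization.norm_inr] at hi

/-- Application of an automorphism followed by conjugation by a family of unitaries. -/
def twistFun (W : I → unitary (Unitization ℂ A)) (β : A ≃⋆ₐ[ℂ] A)
    (x : BddFun I (Unitization ℂ A)) : BddFun I (Unitization ℂ A) :=
  unitaryFun W * autFun β x * bstar (unitaryFun W)

theorem twistFun_val (W : I → unitary (Unitization ℂ A)) (β : A ≃⋆ₐ[ℂ] A)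
    {x : BddFun I (Unitization ℂ A)} {f : I → A}
    (hx : ∀ i, x.1 i = (f i : Unitization ℂ A)) (i : I) :
    (twistFun W β x).1 i = (((conjAut (W i) * β) (f i) : A) : Unitization ℂ A) := by
  have h1 : (conjAut (W i) * β) (f i) = conjAut (W i) (β (f i)) := rfl
  rw [h1, inr_conjAut, ← unitizationHom_inr, ← hx]
  rfl

/-- The additive map of the sequence quotient induced by `twistFun`. -/
def twistQuot (L : Filter I) (W : I → unitary (Unitization ℂ A)) (β : A ≃⋆ₐ[ℂ] A) :
    SeqQuot L (Unitization ℂ A) →+ SeqQuot L (Unitization ℂ A) :=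
  (AddMonoidHom.mulRight (cls L (bstar (unitaryFun W)))).comp
    ((AddMonoidHom.mulLeft (cls L (unitaryFun W))).comp (autQuot L β).toAddMonoidHom)

theorem twistQuot_cls (L : Filter I) (W : I → unitary (Unitization ℂ A)) (β : A ≃⋆ₐ[ℂ] A)
    (x : BddFun I (Unitization ℂ A)) : twistQuot L W β (cls L x) = cls L (twistFun W β x) := by
  rw [twistFun, map_mul, map_mul]
  rfl

variable {G : Type*} [Group G] [Fintype G] [DecidableEq G]

theorem sum_val {ι : Type*} (F : Finset ι) (x : ι → BddFun I (Unitization ℂ A)) {f : ι → I → A}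
    (h : ∀ m i, (x m).1 i = (f m i : Unitization ℂ A)) (i : I) :
    (∑ m ∈ F, x m).1 i = ((∑ m ∈ F, f m i : A) : Unitization ℂ A) := by
  have h1 : ((∑ m ∈ F, f m i : A) : Unitization ℂ A) = ∑ m ∈ F, (f m i : Unitization ℂ A) :=
    map_sum (Unitization.inrHom ℂ ℂ A) (fun m => f m i) F
  rw [AddSubmonoidClass.coe_finsetSum, Finset.sum_apply, h1]
  exact Finset.sum_congr rfl fun m _ => h m i

/-- Consequences of the formula for a twisted automorphism on a partition of unity. -/
theorem twist_identities {Q Y : Type*} [Ring Q] {E : G → Q} {K : Y → Q} {S : G → Q →+ Q}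
    {b b' : G → Y → Y} (hb : ∀ g y, b g (b' g y) = y)
    (hS : ∀ g m y, S g (E m * K y) = E (m * g⁻¹) * K (b' (m * g⁻¹) (b m y)))
    (hmul : ∀ m n y, E m * (E n * K y) = if m = n then E m * K y else 0)
    (hone : ∀ y, ∑ m, E m * K y = K y) :
    (∀ g h m y, S g (S h (E m * K y)) = S (g * h) (E m * K y)) ∧
    (∀ g h y, S g (S h (K y)) = S (g * h) (K y)) ∧
    (∀ g m y, S g (E m * K y) = E (m * g⁻¹) * S g (K y)) ∧
    (∀ g y, S g (K y) = K (b g y) + ∑ m, E m * (K (b' m (b (m * g) y)) - K (b g y))) := by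
  have hSS : ∀ g h m y, S g (S h (E m * K y)) = S (g * h) (E m * K y) := by
    intro g h m y
    -- The telescoping: b' and b at the intermediate index m h⁻¹ cancel.
    rw [hS, hS, hS, hb, mul_inv_rev, mul_assoc]
  have hSK : ∀ g y, S g (K y) = ∑ m, S g (E m * K y) := fun g y => by rw [← map_sum, hone]
  refine ⟨hSS, fun g h y => ?_, fun g m y => ?_, fun g y => ?_⟩
  · rw [hSK h, hSK (g * h), map_sum]
    exact Finset.sum_congr rfl fun m _ => hSS g h m y
  · rw [hSK g y, Finset.mul_sum]
    simp only [hS, hmul, mul_left_inj]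
    simp
  · simp only [mul_sub, Finset.sum_sub_distrib, hone]
    -- Replacing m by mg sends the m-th summand to the block E_m and gives Σ E_m K(b'_m b_{mg} y).
    rw [hSK, ← Equiv.sum_comp (Equiv.mulRight g)]
    simp only [hS, Equiv.coe_mulRight, mul_inv_cancel_right]
    abel

/-- Each identity in the quotient holds up to ε eventually, so one index serves for all of F. Up to
ε, the displacement at y is Σ p_m(β_m⁻¹β_{mg}(y) - β_g(y)). Each summand has norm at most δ, because
β_m⁻¹ is isometric and p_m contractive. The index is chosen independently of δ. -/
theorem exists_rokhlin_step {T : Type v} {l : Filter T} [l.NeBot] {e : T → G → G → A}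
    (he : CentralMatrixUnits l e) {β : G → (A ≃⋆ₐ[ℂ] A)}
    (hβ : ∀ g h : G, ApproxUnitarilyEquiv
      ((β g * β h : A ≃⋆ₐ[ℂ] A) : A →⋆ₙₐ[ℂ] A) (β (g * h) : A →⋆ₙₐ[ℂ] A))
    (F : Finset A) {ε : ℝ} (hε : 0 < ε) :
    ∃ (u : G → unitary (Unitization ℂ A)) (p : G → A), (∀ m, star (p m) = p m) ∧
      (∀ m, ‖p m‖ ≤ 1) ∧ ∀ y ∈ F,
      (∀ δ : ℝ, (∀ g h, ‖β g (β h y) - β (g * h) y‖ ≤ δ) →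
        ∀ g, ‖(conjAut (u g) * β g) y - β g y‖ ≤ Fintype.card G * δ + ε) ∧
      (∀ g h, ‖(conjAut (u g) * β g) ((conjAut (u h) * β h) y) -
        (conjAut (u (g * h)) * β (g * h)) y‖ ≤ ε) ∧
      (∀ g h m, ‖(conjAut (u g) * β g) ((conjAut (u h) * β h) (p m * y)) -
        (conjAut (u (g * h)) * β (g * h)) (p m * y)‖ ≤ ε) ∧
      (∀ g m, ‖(conjAut (u g) * β g) (p m * y) - p (m * g⁻¹) * (conjAut (u g) * β g) y‖ ≤ ε) ∧
      (∀ m, ‖p m * y - y * p m‖ ≤ ε) ∧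
      (∀ m n, ‖p m * (p n * y) - if m = n then p m * y else 0‖ ≤ ε) ∧
      ‖∑ m, p m * y - y‖ ≤ ε := by
  obtain ⟨I, L, hL, a, ha, W, E, hE, hstar, hcomm, hmul, hone, hW⟩ := exists_rokhlin_net he hβ
  set K : A → SeqQuot L (Unitization ℂ A) := fun y => cls L (constFun I y) with hK
  let S : G → SeqQuot L (Unitization ℂ A) →+ SeqQuot L (Unitization ℂ A) :=
    fun g => twistQuot L (W g) (β g)
  have hS : ∀ g m y, S g (E m * K y) = E (m * g⁻¹) * K ((β (m * g⁻¹)).symm (β m y)) := hW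
  obtain ⟨hSS, hSSK, hSE, hSd⟩ := twist_identities
    (b := fun g y => β g y) (b' := fun g y => (β g).symm y)
    (fun g y => (β g).apply_symm_apply y) hS hmul hone
  let P : G → BddFun I (Unitization ℂ A) := fun m => boundedFun (fun i => a i m) 1 fun i => ha i m
  let p : I → G → A := a
  let R : I → G → (A ≃⋆ₐ[ℂ] A) := fun i g => conjAut (W g i) * β g
  have hKv : ∀ (y : A) i, (constFun I y).1 i = (y : Unitization ℂ A) := fun _ _ => rfl
  have hPKv : ∀ m y i, (P m * constFun I y).1 i = ((a i m * y : A) : Unitization ℂ A) :=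
    fun m y i => (Unitization.inr_mul _ _ _).symm
  have key : ∀ y, ∀ᶠ i in L,
      (∀ g, ‖R i g y - (β g y + ∑ m, a i m * ((β m).symm (β (m * g) y) - β g y))‖ ≤ ε) ∧
      (∀ g h, ‖R i g (R i h y) - R i (g * h) y‖ ≤ ε) ∧
      (∀ g h m, ‖R i g (R i h (a i m * y)) - R i (g * h) (a i m * y)‖ ≤ ε) ∧
      (∀ g m, ‖R i g (a i m * y) - a i (m * g⁻¹) * R i g y‖ ≤ ε) ∧
      (∀ m, ‖a i m * y - y * a i m‖ ≤ ε) ∧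
      (∀ m n, ‖a i m * (a i n * y) - if m = n then a i m * y else 0‖ ≤ ε) ∧
      ‖∑ m, a i m * y - y‖ ≤ ε := by
    intro y
    refine (eventually_all.2 fun g => ?_).and <| (eventually_all.2 fun g => eventually_all.2
      fun h => ?_).and <| (eventually_all.2 fun g => eventually_all.2 fun h =>
      eventually_all.2 fun m => ?_).and <| (eventually_all.2 fun g => eventually_all.2
      fun m => ?_).and <| (eventually_all.2 fun m => ?_).and <| (eventually_all.2 fun m =>
      eventually_all.2 fun n => ?_).and ?_
    · have h1 := hSd g y
      simp only [hE, hK, ← map_sub, ← map_mul, ← map_sum, ← map_add, S, twistQuot_cls] at h1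
      refine eventually_norm_sub_le h1 (twistFun_val _ _ (hKv y)) (fun i => ?_) hε
      have h2 := sum_val Finset.univ
        (fun m => P m * (constFun I ((β m).symm (β (m * g) y)) - constFun I (β g y)))
        (f := fun m i => a i m * ((β m).symm (β (m * g) y) - β g y))
        (fun m i => by
          rw [Unitization.inr_mul, Unitization.inr_sub]
          rfl) i
      rw [Unitization.inr_add, ← h2]
      rfl
    · have h1 := hSSK g h y
      simp only [hK, S, twistQuot_cls] at h1
      exact eventually_norm_sub_le h1 (twistFun_val _ _ (twistFun_val _ _ (hKv y)))
        (twistFun_val _ _ (hKv y)) hε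
    · have h1 := hSS g h m y
      simp only [hE, hK, S, ← map_mul, twistQuot_cls] at h1
      exact eventually_norm_sub_le h1 (twistFun_val _ _ (twistFun_val _ _ (hPKv m y)))
        (twistFun_val _ _ (hPKv m y)) hε
    · have h1 := hSE g m y
      simp only [hE, hK, S, ← map_mul, twistQuot_cls] at h1
      refine eventually_norm_sub_le h1 (twistFun_val _ _ (hPKv m y)) (fun i => ?_) hε
      rw [Unitization.inr_mul, ← twistFun_val _ _ (hKv y)]
      rfl
    · have h1 := hcomm m y
      simp only [hE, ← map_mul] at h1
      exact eventually_norm_sub_le h1 (hPKv m y) (fun i => (Unitization.inr_mul _ _ _).symm) hε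
    · have h1 := hmul m n y
      by_cases hmn : m = n
      · simp only [hE, ← map_mul, if_pos hmn] at h1 ⊢
        refine eventually_norm_sub_le h1 (fun i => ?_) (hPKv m y) hε
        rw [Unitization.inr_mul, Unitization.inr_mul]
        rfl
      · simp only [hE, ← map_mul, if_neg hmn] at h1 ⊢
        rw [← map_zero (cls L)] at h1
        refine eventually_norm_sub_le h1 (fun i => ?_) (fun i => rfl) hε
        rw [Unitization.inr_mul, Unitization.inr_mul]
        rfl
    · have h1 := hone y
      simp only [hE, ← map_mul, ← map_sum] at h1
      exact eventually_norm_sub_le h1 (sum_val _ _ fun m i => hPKv m y i) (hKv y) hε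
  obtain ⟨i, hi⟩ := ((F.eventually_all (l := L)).2 fun y _ => key y).exists
  refine ⟨fun g => W g i, a i, hstar i, ha i, fun y hy => ⟨fun δ hδ g => ?_, (hi y hy).2⟩⟩
  have h1 := (hi y hy).1 g
  have h2 : ‖∑ m, a i m * ((β m).symm (β (m * g) y) - β g y)‖ ≤ Fintype.card G * δ := by
    refine (norm_sum_le_of_le (n := fun _ => δ) _ fun m _ => ?_).trans (by simp)
    have h3 : ‖(β m).symm (β (m * g) y) - β g y‖ ≤ δ := by
      have h4 : (β m).symm (β (m * g) y) - β g y =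
          (β m).symm (β (m * g) y - β m (β g y)) := by simp
      rw [h4]
      exact (NonUnitalStarAlgHom.norm_apply_le _ _).trans (by rw [norm_sub_rev]; exact hδ m g)
    exact (norm_mul_le _ _).trans ((mul_le_of_le_one_left (norm_nonneg _) (ha i m)).trans h3)
  change ‖R i g y - β g y‖ ≤ _
  calc ‖R i g y - β g y‖
      = ‖(R i g y - (β g y + ∑ m, a i m * ((β m).symm (β (m * g) y) - β g y))) +
        ∑ m, a i m * ((β m).symm (β (m * g) y) - β g y)‖ := by congr 1; abel
    _ ≤ ε + Fintype.card G * δ := (norm_add_le _ _).trans (add_le_add h1 h2)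
    _ = _ := add_comm _ _

end RokhlinStep

/-! ### The Rokhlin property from a sequence of approximate towers. -/

section RokhlinCriterion

variable {A : Type*} [NonUnitalCStarAlgebra A]

/-- Multiplication on one side suffices, as the elements commute with A. -/
theorem annSeq_proj_eq_iff {c d : centralSeq A} :
    (annSeq A).proj c = (annSeq A).proj d ↔
      ∀ a : A, (c : SeqAlg A) * toSeqAlg A a = (d : SeqAlg A) * toSeqAlg A a := by
  rw [StarIdeal.proj_eq_iff]
  constructor
  · intro h a
    have h1 := (h a).1
    rwa [NonUnitalStarSubalgebra.coe_sub, sub_mul, sub_eq_zero] at h1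
  · intro h a
    have h1 : ((c - d : centralSeq A) : SeqAlg A) * toSeqAlg A a = 0 := by
      rw [NonUnitalStarSubalgebra.coe_sub, sub_mul, h, sub_self]
    exact ⟨h1, (mem_centralSeq.1 (c - d).2 a).trans h1⟩

theorem nullSeq_proj_eq_iff {x y : BoundedSeq A} :
    (nullSeq A).proj x = (nullSeq A).proj y ↔ Tendsto (fun n => x n - y n) atTop (𝓝 0) :=
  StarIdeal.proj_eq_iff _

variable {G : Type*} [Group G] [Fintype G]

/-- The bounded sequence associated with a function on `G` and a sequence of families of
contractions indexed by `G`. -/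
def combSeq (P : ℕ → G → A) (hP : ∀ n m, ‖P n m‖ ≤ 1) (f : G → ℂ) : BoundedSeq A :=
  BoundedContinuousFunction.ofNormedAddCommGroupDiscrete (fun n => ∑ k, f k • P n k⁻¹)
    (∑ k, ‖f k‖) fun n => norm_sum_le_of_le _ fun k _ => by
      rw [norm_smul]
      exact mul_le_of_le_one_right (norm_nonneg _) (hP _ _)

theorem combSeq_apply (P : ℕ → G → A) (hP : ∀ n m, ‖P n m‖ ≤ 1) (f : G → ℂ) (n : ℕ) :
    combSeq P hP f n = ∑ k, f k • P n k⁻¹ := rfl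

theorem combSeq_mem_centralSeq (P : ℕ → G → A) (hP : ∀ n m, ‖P n m‖ ≤ 1)
    (hcomm : ∀ m a, Tendsto (fun n => P n m * a - a * P n m) atTop (𝓝 0)) (f : G → ℂ) :
    (nullSeq A).proj (combSeq P hP f) ∈ centralSeq A := by
  refine mem_centralSeq.2 fun a => Eq.symm ?_
  change (nullSeq A).proj (combSeq P hP f * constSeq A a) =
    (nullSeq A).proj (constSeq A a * combSeq P hP f)
  rw [nullSeq_proj_eq_iff]
  have h : Tendsto (fun n => ∑ k, f k • (P n k⁻¹ * a - a * P n k⁻¹)) atTop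
      (𝓝 (∑ k : G, f k • (0 : A))) :=
    tendsto_finsetSum _ fun k _ => (hcomm _ _).const_smul _
  simp only [smul_zero, Finset.sum_const_zero] at h
  refine h.congr fun n => ?_
  change _ = combSeq P hP f n * a - a * combSeq P hP f n
  simp only [combSeq_apply, Finset.sum_mul, Finset.mul_sum, ← Finset.sum_sub_distrib, smul_sub,
    smul_mul_assoc, mul_smul_comm]

/-- The tower is moved by right translation, m ↦ m g⁻¹, while C(G) carries the left shift. In
`combSeq` the value f k is therefore attached to P_{k⁻¹}, since k⁻¹g⁻¹ = (gk)⁻¹. -/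
theorem hasRokhlinProperty_of_seq [DecidableEq G] (γ : G →* (A ≃⋆ₐ[ℂ] A)) (P : ℕ → G → A)
    (hP : ∀ n m, ‖P n m‖ ≤ 1) (hs : ∀ n m, star (P n m) = P n m)
    (hcomm : ∀ m a, Tendsto (fun n => P n m * a - a * P n m) atTop (𝓝 0))
    (hmul : ∀ m k a, Tendsto (fun n => P n m * (P n k * a) - if m = k then P n m * a else 0)
      atTop (𝓝 0))
    (hone : ∀ a, Tendsto (fun n => ∑ m, P n m * a - a) atTop (𝓝 0))
    (hγ : ∀ g m a, Tendsto (fun n => γ g (P n m * a) - P n (m * g⁻¹) * γ g a) atTop (𝓝 0)) :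
    HasRokhlinProperty γ := by
  let ξ : (G → ℂ) → centralSeq A := fun f =>
    ⟨(nullSeq A).proj (combSeq P hP f), combSeq_mem_centralSeq P hP hcomm f⟩
  have hξ : ∀ f a, (ξ f : SeqAlg A) * toSeqAlg A a =
      (nullSeq A).proj (combSeq P hP f * constSeq A a) := fun f a => rfl
  let φ : (G → ℂ) →⋆ₙₐ[ℂ] CentralSeqAlg A :=
    { toFun := fun f => (annSeq A).proj (ξ f)
      map_smul' := fun c f => by
        rw [MonoidHom.id_apply, ← map_smul]
        congr 1
        apply Subtype.ext
        change (nullSeq A).proj _ = c • (nullSeq A).proj _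
        rw [← map_smul]
        congr 1
        ext n
        simp [combSeq_apply, Finset.smul_sum, mul_smul]
      map_zero' := by
        rw [← map_zero (annSeq A).proj]
        congr 1
        apply Subtype.ext
        change (nullSeq A).proj _ = 0
        rw [← map_zero (nullSeq A).proj]
        congr 1
        ext n
        simp [combSeq_apply]
      map_add' := fun f k => by
        rw [← map_add]
        congr 1
        apply Subtype.ext
        change (nullSeq A).proj _ = (nullSeq A).proj _ + (nullSeq A).proj _
        rw [← map_add]
        congr 1
        ext n
        simp [combSeq_apply, add_smul, Finset.sum_add_distrib]
      map_mul' := fun f k => by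
        rw [← map_mul, annSeq_proj_eq_iff]
        intro a
        change (nullSeq A).proj (combSeq P hP (f * k) * constSeq A a) =
          (nullSeq A).proj (combSeq P hP f * combSeq P hP k * constSeq A a)
        rw [nullSeq_proj_eq_iff]
        have h : Tendsto (fun n => ∑ i, ∑ j, (f i * k j) • (P n i⁻¹ * (P n j⁻¹ * a) -
            if i⁻¹ = j⁻¹ then P n i⁻¹ * a else 0)) atTop
            (𝓝 (∑ i : G, ∑ j : G, (f i * k j) • (0 : A))) :=
          tendsto_finsetSum _ fun i _ => tendsto_finsetSum _ fun j _ => (hmul _ _ _).const_smul _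
        simp only [smul_zero, Finset.sum_const_zero] at h
        rw [← neg_zero]
        refine h.neg.congr fun n => ?_
        change _ = combSeq P hP (f * k) n * a - combSeq P hP f n * combSeq P hP k n * a
        have h3 : combSeq P hP f n * combSeq P hP k n * a =
            ∑ i, ∑ j, (f i * k j) • (P n i⁻¹ * (P n j⁻¹ * a)) := by
          rw [mul_assoc, combSeq_apply, combSeq_apply, Finset.sum_mul _ _ a, Finset.sum_mul_sum]
          refine Finset.sum_congr rfl fun i _ => Finset.sum_congr rfl fun j _ => ?_
          rw [smul_mul_assoc, smul_mul_assoc, mul_smul_comm, smul_smul]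
        rw [h3]
        simp only [combSeq_apply, smul_sub, Finset.sum_sub_distrib, neg_sub, inv_inj, smul_ite,
          smul_zero, Finset.sum_ite_eq, Finset.mem_univ, if_true, Pi.mul_apply, Finset.sum_mul,
          smul_mul_assoc]
      map_star' := fun f => by
        rw [← map_star]
        congr 1
        apply Subtype.ext
        change (nullSeq A).proj _ = star ((nullSeq A).proj _)
        rw [← map_star]
        congr 1
        ext n
        simp [combSeq_apply, hs] }
  have hφ : ∀ f, φ f = (annSeq A).proj (ξ f) := fun _ => rfl
  refine ⟨φ, fun x => ?_, fun g f => ?_⟩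
  · obtain ⟨c, rfl⟩ := (annSeq A).proj_surjective x
    have h1 : ∀ a, (ξ 1 : SeqAlg A) * toSeqAlg A a = toSeqAlg A a := by
      intro a
      rw [hξ]
      refine nullSeq_proj_eq_iff.2 ((hone a).congr fun n => ?_)
      change _ = combSeq P hP 1 n * a - a
      rw [combSeq_apply, ← Finset.sum_mul, ← Equiv.sum_comp (Equiv.inv G)]
      simp
    rw [hφ, ← map_mul, ← map_mul, annSeq_proj_eq_iff, annSeq_proj_eq_iff]
    refine ⟨fun a => ?_, fun a => ?_⟩
    · rw [NonUnitalStarSubalgebra.coe_mul, mul_assoc, ← mem_centralSeq.1 c.2 a, ← mul_assoc, h1]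
    · rw [NonUnitalStarSubalgebra.coe_mul, mul_assoc, h1]
  · change (annSeq A).proj (ξ _) = (annSeq A).proj (centralSeqMap (γ g) (ξ f))
    rw [annSeq_proj_eq_iff]
    intro a
    change (nullSeq A).proj (combSeq P hP _ * constSeq A a) =
      (nullSeq A).proj (seqMap (γ g) (combSeq P hP f) * constSeq A a)
    rw [nullSeq_proj_eq_iff]
    have h : Tendsto (fun n => ∑ k, f k • (γ g (P n k⁻¹ * (γ g).symm a) -
        P n (k⁻¹ * g⁻¹) * γ g ((γ g).symm a))) atTop (𝓝 (∑ k : G, f k • (0 : A))) :=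
      tendsto_finsetSum _ fun k _ => (hγ _ _ _).const_smul _
    simp only [smul_zero, Finset.sum_const_zero] at h
    rw [← neg_zero]
    refine h.neg.congr fun n => ?_
    change _ = combSeq P hP (fun h => f (g⁻¹ * h)) n * a - γ g (combSeq P hP f n) * a
    have hc : combSeq P hP (fun h => f (g⁻¹ * h)) n = ∑ k, f k • P n (k⁻¹ * g⁻¹) := by
      rw [combSeq_apply, ← Equiv.sum_comp (Equiv.mulLeft g)]
      simp only [Equiv.coe_mulLeft, inv_mul_cancel_left, mul_inv_rev]
    rw [hc, combSeq_apply]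
    simp only [smul_sub, Finset.sum_sub_distrib, neg_sub, StarAlgEquiv.apply_symm_apply, map_mul,
      map_sum, map_smul, Finset.sum_mul, smul_mul_assoc]

end RokhlinCriterion

/-! ### Limits of approximately multiplicative families. -/

section LimitAction

variable {A : Type*} [NonUnitalCStarAlgebra A] {G : Type*} [Group G]

/-- Summable displacements on a dense set and isometry give convergence everywhere, and
multiplicativity passes to the limit. Surjectivity comes from the group: the limit at 1 is
idempotent and isometric, hence the identity, so the limits at g and g⁻¹ are inverse to each other.
-/
theorem exists_limit_action (b : ℕ → G → (A ≃⋆ₐ[ℂ] A)) (F : ℕ → Set A) (hF : Monotone F)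
    (hd : Dense (⋃ n, F n)) (D : ℝ)
    (h1 : ∀ n, ∀ y ∈ F n, ∀ g, ‖b (n + 1) g y - b n g y‖ ≤ D / 2 ^ n)
    (h2 : ∀ n, ∀ y ∈ F (n + 1), ∀ g h,
      ‖b (n + 1) g (b (n + 1) h y) - b (n + 1) (g * h) y‖ ≤ 1 / 2 ^ n) :
    ∃ γ : G →* (A ≃⋆ₐ[ℂ] A), (∀ g a, Tendsto (fun n => b n g a) atTop (𝓝 (γ g a))) ∧
      ∀ n, ∀ y ∈ F n, ∀ g, ‖γ g y - b n g y‖ ≤ 2 * D / 2 ^ n := by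
  -- The bound has the shape C/2/2^k, which sums to C = 2D/2^N.
  have hstep : ∀ N, ∀ y ∈ F N, ∀ g k,
      dist (b (N + k) g y) (b (N + (k + 1)) g y) ≤ (2 * D / 2 ^ N) / 2 / 2 ^ k := by
    intro N y hy g k
    rw [dist_comm, dist_eq_norm]
    refine (h1 (N + k) y (hF (Nat.le_add_right _ _) hy) g).trans_eq ?_
    rw [pow_add]
    field_simp
  have hiso : ∀ n g (x y : A), ‖b n g x - b n g y‖ = ‖x - y‖ := fun n g x y => by
    rw [← map_sub, StarAlgEquiv.norm_map]
  have hcauchy : ∀ g a, CauchySeq fun n => b n g a := by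
    intro g a
    rw [Metric.cauchySeq_iff']
    intro ε hε
    obtain ⟨y, hy, hya⟩ := hd.exists_dist_lt a (show 0 < ε / 3 by positivity)
    obtain ⟨N, hN⟩ := Set.mem_iUnion.1 hy
    have hc : CauchySeq fun n => b n g y := by
      have := cauchySeq_of_le_geometric_two (hstep N y hN g)
      refine (cauchySeq_shift (u := fun n => b n g y) N).1 ?_
      simpa only [add_comm] using this
    obtain ⟨M, hM⟩ := Metric.cauchySeq_iff'.1 hc (ε / 3) (by positivity)
    refine ⟨M, fun n hn => ?_⟩
    have h3 := hM n hn
    rw [dist_eq_norm] at h3 hya ⊢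
    have h4 := hiso n g a y
    have h5 := hiso M g y a
    rw [norm_sub_rev y a] at h5
    calc ‖b n g a - b M g a‖
        = ‖(b n g a - b n g y) + (b n g y - b M g y) + (b M g y - b M g a)‖ := by congr 1; abel
      _ ≤ _ := norm_add₃_le
      _ < ε := by linarith
  choose Γ hΓ using fun g a => cauchySeq_tendsto_of_complete (hcauchy g a)
  have hΓb : ∀ n, ∀ y ∈ F n, ∀ g, ‖Γ g y - b n g y‖ ≤ 2 * D / 2 ^ n := by
    intro n y hy g
    rw [norm_sub_rev, ← dist_eq_norm]
    have h3 : Tendsto (fun k => b (n + k) g y) atTop (𝓝 (Γ g y)) := by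
      simpa only [add_comm] using (tendsto_add_atTop_iff_nat n).2 (hΓ g y)
    exact dist_le_of_le_geometric_two_of_tendsto₀ (hstep n y hy g) h3
  have hΓiso : ∀ g x y, ‖Γ g x - Γ g y‖ = ‖x - y‖ := fun g x y =>
    tendsto_nhds_unique ((hΓ g x).sub (hΓ g y)).norm (by simpa only [hiso] using tendsto_const_nhds)
  have hcont : ∀ g, Continuous (Γ g) := fun g =>
    (Isometry.of_dist_eq fun x y => by rw [dist_eq_norm, dist_eq_norm, hΓiso]).continuous
  have hcomp : ∀ g h a, Tendsto (fun n => b n g (b n h a)) atTop (𝓝 (Γ g (Γ h a))) := by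
    intro g h a
    rw [tendsto_iff_norm_sub_tendsto_zero]
    have h3 := (tendsto_iff_norm_sub_tendsto_zero.1 (hΓ h a)).add
      (tendsto_iff_norm_sub_tendsto_zero.1 (hΓ g (Γ h a)))
    rw [add_zero] at h3
    refine squeeze_zero (fun _ => norm_nonneg _) (fun n => ?_) h3
    rw [← hiso n g (b n h a)]
    exact norm_sub_le_norm_sub_add_norm_sub _ _ _
  have hmul : ∀ g h a, Γ g (Γ h a) = Γ (g * h) a := by
    intro g h
    refine congrFun (Continuous.ext_on hd ((hcont g).comp (hcont h)) (hcont (g * h)) ?_)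
    intro y hy
    obtain ⟨N, hN⟩ := Set.mem_iUnion.1 hy
    have h3 := (hcomp g h y).sub (hΓ (g * h) y)
    have h4 : Tendsto (fun n => b n g (b n h y) - b n (g * h) y) atTop (𝓝 0) := by
      rw [← tendsto_add_atTop_iff_nat 1]
      have h5 : Tendsto (fun n : ℕ => (1 : ℝ) / 2 ^ n) atTop (𝓝 0) :=
        tendsto_const_nhds.div_atTop (tendsto_pow_atTop_atTop_of_one_lt one_lt_two)
      refine squeeze_zero_norm' ?_ h5
      filter_upwards [eventually_ge_atTop N] with n hn
      exact h2 n y (hF (hn.trans n.le_succ) hN) g h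
    exact sub_eq_zero.1 (tendsto_nhds_unique h3 h4)
  have hone : ∀ a, Γ 1 a = a := by
    intro a
    have h3 := hmul 1 1 a
    have h4 := hΓiso 1 (Γ 1 a) a
    rw [mul_one] at h3
    rw [h3, sub_self, norm_zero] at h4
    exact sub_eq_zero.1 (norm_eq_zero.1 h4.symm)
  let γ : G → (A ≃⋆ₐ[ℂ] A) := fun g =>
    { toFun := Γ g
      invFun := Γ g⁻¹
      left_inv := fun a => by rw [hmul, inv_mul_cancel, hone]
      right_inv := fun a => by rw [hmul, mul_inv_cancel, hone]
      map_mul' := fun x y => tendsto_nhds_unique (hΓ g (x * y)) <| by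
        simpa only [map_mul] using (hΓ g x).mul (hΓ g y)
      map_add' := fun x y => tendsto_nhds_unique (hΓ g (x + y)) <| by
        simpa only [map_add] using (hΓ g x).add (hΓ g y)
      map_star' := fun x => tendsto_nhds_unique (hΓ g (star x)) <| by
        simpa only [map_star] using (hΓ g x).star
      map_smul' := fun c x => tendsto_nhds_unique (hΓ g (c • x)) <| by
        simpa only [map_smul] using (hΓ g x).const_smul c }
  refine ⟨⟨⟨γ, StarAlgEquiv.ext hone⟩, fun g h => StarAlgEquiv.ext fun a => (hmul g h a).symm⟩,
    hΓ, hΓb⟩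

end LimitAction

/-! ### Iterating the correction step. -/

section Iteration

variable {A : Type*} [NonUnitalCStarAlgebra A] {G : Type*} [Group G]

theorem conjAut_mul (u v : unitary (Unitization ℂ A)) :
    conjAut (u * v) = conjAut u * conjAut v := by
  refine StarAlgEquiv.ext fun a => ?_
  apply Unitization.inr_injective (R := ℂ)
  change _ = ((conjAut u (conjAut v a) : A) : Unitization ℂ A)
  rw [inr_conjAut, inr_conjAut, inr_conjAut]
  simp [mul_assoc]

theorem conjAut_one : conjAut (1 : unitary (Unitization ℂ A)) = 1 := by
  refine StarAlgEquiv.ext fun a => ?_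
  apply Unitization.inr_injective (R := ℂ)
  rw [inr_conjAut]
  simp

/-- A family that is multiplicative up to approximate unitary equivalence remains so after
perturbation by inner automorphisms. -/
theorem approxUnitarilyEquiv_conjAut_mul {β : G → (A ≃⋆ₐ[ℂ] A)}
    (hβ : ∀ g h : G, ApproxUnitarilyEquiv
      ((β g * β h : A ≃⋆ₐ[ℂ] A) : A →⋆ₙₐ[ℂ] A) (β (g * h) : A →⋆ₙₐ[ℂ] A))
    (u : G → unitary (Unitization ℂ A)) (g h : G) :
    ApproxUnitarilyEquiv
      ((conjAut (u g) * β g * (conjAut (u h) * β h) : A ≃⋆ₐ[ℂ] A) : A →⋆ₙₐ[ℂ] A)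
      ((conjAut (u (g * h)) * β (g * h) : A ≃⋆ₐ[ℂ] A) : A →⋆ₙₐ[ℂ] A) := by
  obtain ⟨x, hx⟩ := hβ g h
  -- Moving Ad(u_h) past β_g turns the composite into Ad(y)β_gβ_h with y = u_g β_g(u_h). The new
  -- unitaries undo y, apply those given for β_gβ_h ≈ β_{gh}, and then apply u_{gh}.
  let y : unitary (Unitization ℂ A) :=
    u g * ⟨unitizationHom (β g) (u h), Unitary.map_mem _ (u h).2⟩
  refine ⟨fun n => u (g * h) * x n * star y, fun a => ?_⟩
  have h1 : (((conjAut (u g) * β g * (conjAut (u h) * β h) : A ≃⋆ₐ[ℂ] A) a : A) :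
      Unitization ℂ A) = y * ((β g (β h a) : A) : Unitization ℂ A) * star (y : Unitization ℂ A) := by
    change ((conjAut (u g) (β g (conjAut (u h) (β h a))) : A) : Unitization ℂ A) = _
    rw [inr_conjAut, ← unitizationHom_inr, inr_conjAut, map_mul, map_mul, map_star,
      unitizationHom_inr]
    simp [y, mul_assoc]
  have h2 : (((conjAut (u (g * h)) * β (g * h) : A ≃⋆ₐ[ℂ] A) a : A) : Unitization ℂ A) =
      u (g * h) * ((β (g * h) a : A) : Unitization ℂ A) *
        star (u (g * h) : Unitization ℂ A) := inr_conjAut _ _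
  have h3 := ((hx a).const_mul (u (g * h) : Unitization ℂ A)).mul_const
    (star (u (g * h) : Unitization ℂ A))
  change Tendsto _ _ (𝓝 (((conjAut (u (g * h)) * β (g * h) : A ≃⋆ₐ[ℂ] A) a : A) :
    Unitization ℂ A))
  rw [h2]
  refine h3.congr fun n => ?_
  change _ = _ * (((conjAut (u g) * β g * (conjAut (u h) * β h) : A ≃⋆ₐ[ℂ] A) a : A) :
    Unitization ℂ A) * _
  rw [h1]
  have h4 : ∀ z, star (y : Unitization ℂ A) * (y * z) = z := fun z => by
    rw [← mul_assoc, Unitary.star_mul_self_of_mem y.2, one_mul]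
  simp only [Submonoid.coe_mul, Unitary.coe_star, star_mul, star_star, mul_assoc, h4]
  rfl

/-- A stage of the iteration: perturbing unitaries, a finite set on which the perturbed family is
under control, and a family of elements indexed by the group. -/
structure Stage (G A : Type*) [NonUnitalCStarAlgebra A] where
  unitaries : G → unitary (Unitization ℂ A)
  set : Finset A
  tower : G → A

/-- The perturbed family of automorphisms of a stage. -/
def Stage.aut (β : G → (A ≃⋆ₐ[ℂ] A)) (s : Stage G A) (g : G) : A ≃⋆ₐ[ℂ] A :=
  conjAut (s.unitaries g) * β g

variable [Fintype G] [DecidableEq G]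

theorem exists_next_stage {T : Type v} {l : Filter T} [l.NeBot] {e : T → G → G → A}
    (he : CentralMatrixUnits l e) {β : G → (A ≃⋆ₐ[ℂ] A)}
    (hβ : ∀ g h : G, ApproxUnitarilyEquiv
      ((β g * β h : A ≃⋆ₐ[ℂ] A) : A →⋆ₙₐ[ℂ] A) (β (g * h) : A →⋆ₙₐ[ℂ] A))
    (s : Stage G A) (F : Finset A) {ε : ℝ} (hε : 0 < ε) :
    ∃ s' : Stage G A, s.set ⊆ s'.set ∧ F ⊆ s'.set ∧
      (∀ m, star (s'.tower m) = s'.tower m) ∧ (∀ m, ‖s'.tower m‖ ≤ 1) ∧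
      (∀ y ∈ s.set, ∀ δ : ℝ, (∀ g h, ‖s.aut β g (s.aut β h y) - s.aut β (g * h) y‖ ≤ δ) →
        ∀ g, ‖s'.aut β g y - s.aut β g y‖ ≤ Fintype.card G * δ + ε) ∧
      (∀ y ∈ s'.set, ∀ g h, ‖s'.aut β g (s'.aut β h y) - s'.aut β (g * h) y‖ ≤ ε) ∧
      ∀ y ∈ F, (∀ m, s'.tower m * y ∈ s'.set) ∧
        (∀ g m, ‖s'.aut β g (s'.tower m * y) - s'.tower (m * g⁻¹) * s'.aut β g y‖ ≤ ε) ∧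
        (∀ m, ‖s'.tower m * y - y * s'.tower m‖ ≤ ε) ∧
        (∀ m n, ‖s'.tower m * (s'.tower n * y) - if m = n then s'.tower m * y else 0‖ ≤ ε) ∧
        ‖∑ m, s'.tower m * y - y‖ ≤ ε := by
  classical
  obtain ⟨u, p, hp, hp1, hF⟩ := exists_rokhlin_step he (β := s.aut β)
    (approxUnitarilyEquiv_conjAut_mul hβ s.unitaries) (s.set ∪ F) hε
  -- The products p_m z join the controlled set, so that later corrections move them little and the
  -- equivariance of this tower survives in the limit.
  let s' : Stage G A := ⟨fun g => u g * s.unitaries g,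
    (s.set ∪ F) ∪ (Finset.univ ×ˢ (s.set ∪ F)).image fun x : G × A => p x.1 * x.2, p⟩
  have haut : ∀ g, s'.aut β g = conjAut (u g) * s.aut β g := fun g => by
    simp only [Stage.aut, s', conjAut_mul, mul_assoc]
  refine ⟨s', fun y hy => ?_, fun y hy => ?_, hp, hp1, fun y hy => ?_, fun y hy => ?_,
    fun y hy => ?_⟩
  · exact Finset.mem_union_left _ (Finset.mem_union_left _ hy)
  · exact Finset.mem_union_left _ (Finset.mem_union_right _ hy)
  · simp only [haut]
    exact (hF y (Finset.mem_union_left _ hy)).1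
  · simp only [haut]
    rcases Finset.mem_union.1 hy with hy | hy
    · exact (hF y hy).2.1
    · obtain ⟨⟨m, z⟩, hz, rfl⟩ := Finset.mem_image.1 hy
      exact fun g h => (hF z (Finset.mem_product.1 hz).2).2.2.1 g h m
  · simp only [haut]
    refine ⟨fun m => ?_, (hF y (Finset.mem_union_right _ hy)).2.2.2⟩
    exact Finset.mem_union_right _ (Finset.mem_image.2
      ⟨(m, y), Finset.mem_product.2 ⟨Finset.mem_univ _, Finset.mem_union_right _ hy⟩, rfl⟩)

theorem exists_rokhlin_action [TopologicalSpace.SeparableSpace A] {T : Type v} {l : Filter T}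
    [l.NeBot] {e : T → G → G → A} (he : CentralMatrixUnits l e) {β : G → (A ≃⋆ₐ[ℂ] A)}
    (hβ : ∀ g h : G, ApproxUnitarilyEquiv
      ((β g * β h : A ≃⋆ₐ[ℂ] A) : A →⋆ₙₐ[ℂ] A) (β (g * h) : A →⋆ₙₐ[ℂ] A)) :
    ∃ γ : G →* (A ≃⋆ₐ[ℂ] A), HasRokhlinProperty γ ∧
      ∀ g : G, ApproxUnitarilyEquiv (γ g : A →⋆ₙₐ[ℂ] A) (β g : A →⋆ₙₐ[ℂ] A) := by
  classical
  let d : ℕ → A := TopologicalSpace.denseSeq A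
  have hdd : DenseRange d := TopologicalSpace.denseRange_denseSeq A
  let F : ℕ → Finset A := fun n => (Finset.range (n + 1)).image d
  have hFd : ∀ k n, k ≤ n → d k ∈ F n := fun k n hkn =>
    Finset.mem_image_of_mem d (Finset.mem_range.2 (Nat.lt_succ_of_le hkn))
  choose next hset hFset hstar hnorm hclose happrox htower using
    fun (n : ℕ) (s : Stage G A) => exists_next_stage he hβ s (F n)
      (ε := 1 / 2 ^ n) (by positivity)
  -- The initial set is empty because the defects of β itself are not small; the first displacement
  -- needs no bound.
  let st : ℕ → Stage G A := fun n => Nat.rec ⟨1, ∅, 0⟩ (fun n s => next n s) n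
  have hst : ∀ n, st (n + 1) = next n (st n) := fun n => rfl
  let b : ℕ → G → (A ≃⋆ₐ[ℂ] A) := fun n => (st n).aut β
  let P : ℕ → G → A := fun n => (st (n + 1)).tower
  have hmono : Monotone fun n => ((st n).set : Set A) := monotone_nat_of_le_succ fun n => by
    rw [hst]
    exact Finset.coe_subset.2 (hset n (st n))
  have hdense : Dense (⋃ n, ((st n).set : Set A)) := by
    refine hdd.mono ?_
    rintro _ ⟨k, rfl⟩
    refine Set.mem_iUnion.2 ⟨k + 1, ?_⟩
    rw [hst]
    exact hFset k (st k) (hFd k k le_rfl)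
  obtain ⟨γ, hγlim, hγb⟩ := exists_limit_action b (fun n => ((st n).set : Set A)) hmono hdense
    -- At stage n + 1 the defects on the current set are at most 1/2^n, so the next displacement is
    -- at most |G|/2^n + 1/2^(n+1) = (2|G| + 1)/2^(n+1).
    (2 * Fintype.card G + 1)
    (fun n y hy g => by
      have h1 := hclose n (st n) y hy
      rcases n with _ | n
      · exact absurd hy (Finset.notMem_empty y)
      · refine (h1 (1 / 2 ^ n) (happrox n (st n) y hy) g).trans_eq ?_
        rw [pow_succ]
        field_simp)
    (fun n y hy g h => happrox n (st n) y hy g h)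
  have htow : ∀ k n, k ≤ n → _ := fun k n hkn => htower n (st n) (d k) (hFd k n hkn)
  have hpow : Tendsto (fun n : ℕ => (1 : ℝ) / 2 ^ n) atTop (𝓝 0) :=
    tendsto_const_nhds.div_atTop (tendsto_pow_atTop_atTop_of_one_lt one_lt_two)
  have hP1 : ∀ n m, ‖P n m‖ ≤ 1 := fun n m => hnorm n (st n) m
  have hle : ∀ n m a, ‖P n m * a‖ ≤ ‖a‖ := fun n m a =>
    (norm_mul_le _ _).trans (mul_le_of_le_one_left (norm_nonneg _) (hP1 n m))
  have hle' : ∀ n m a, ‖a * P n m‖ ≤ ‖a‖ := fun n m a =>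
    (norm_mul_le _ _).trans (mul_le_of_le_one_right (norm_nonneg _) (hP1 n m))
  have hdensity : ∀ (Φ : ℕ → A →+ A) (C K : ℝ), (∀ n a, ‖Φ n a‖ ≤ C * ‖a‖) →
      (∀ k n, k ≤ n → ‖Φ n (d k)‖ ≤ K * (1 / 2 ^ n)) →
      ∀ a, Tendsto (fun n => Φ n a) atTop (𝓝 0) := by
    intro Φ C K hΦ h
    refine tendsto_zero_of_dense Φ C hΦ hdd ?_
    rintro _ ⟨k, rfl⟩
    have h1 := hpow.const_mul K
    rw [mul_zero] at h1
    exact squeeze_zero_norm' ((eventually_ge_atTop k).mono fun n hn => h k n hn) h1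
  refine ⟨γ, hasRokhlinProperty_of_seq γ P hP1 (fun n m => hstar n (st n) m) (fun m => ?_)
    (fun m k => ?_) ?_ (fun g m => ?_), fun g => ⟨fun n => star ((st n).unitaries g), fun a => ?_⟩⟩
  · refine hdensity (fun n => AddMonoidHom.mulLeft (P n m) - AddMonoidHom.mulRight (P n m)) 2 1
      (fun n a => ?_) fun k n hkn => ?_
    · refine (norm_sub_le _ _).trans ?_
      have h1 := hle n m a
      have h2 := hle' n m a
      simp only [AddMonoidHom.coe_mulLeft, AddMonoidHom.coe_mulRight]
      linarith
    · rw [one_mul]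
      exact (htow k n hkn).2.2.1 m
  · intro a
    have hΦ := hdensity (fun n => (AddMonoidHom.mulLeft (P n m)).comp
      (AddMonoidHom.mulLeft (P n k)) - if m = k then AddMonoidHom.mulLeft (P n m) else 0) 2 1
      (fun n a => ?_) (fun j n hjn => ?_) a
    · refine hΦ.congr fun n => ?_
      split_ifs <;> rfl
    · refine (norm_sub_le _ _).trans ?_
      have h1 : ‖P n m * (P n k * a)‖ ≤ ‖a‖ := (hle _ _ _).trans (hle _ _ _)
      have h2 : ‖(if m = k then AddMonoidHom.mulLeft (P n m) else 0 : A →+ A) a‖ ≤ ‖a‖ := by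
        split_ifs
        · exact hle _ _ _
        · simp
      change ‖P n m * (P n k * a)‖ + _ ≤ _
      linarith
    · rw [one_mul]
      refine le_trans (le_of_eq ?_) ((htow j n hjn).2.2.2.1 m k)
      congr 1
      split_ifs <;> rfl
  · refine fun a => (hdensity (fun n => (∑ m, AddMonoidHom.mulLeft (P n m)) - AddMonoidHom.id A)
      (Fintype.card G + 1) 1 (fun n a => ?_) (fun k n hkn => ?_) a).congr fun n => ?_
    · have h1 : ‖∑ m, P n m * a‖ ≤ ∑ _m : G, ‖a‖ := norm_sum_le_of_le _ fun m _ => hle _ _ _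
      have h2 := norm_sub_le (∑ m, P n m * a) a
      simp only [Finset.sum_const, nsmul_eq_mul, Finset.card_univ] at h1
      simp only [AddMonoidHom.sub_apply, AddMonoidHom.finsetSum_apply, AddMonoidHom.coe_mulLeft,
        AddMonoidHom.id_apply]
      linarith
    · rw [one_mul]
      refine le_trans (le_of_eq ?_) (htow k n hkn).2.2.2.2
      simp only [AddMonoidHom.sub_apply, AddMonoidHom.finsetSum_apply, AddMonoidHom.coe_mulLeft,
        AddMonoidHom.id_apply]
      rfl
    · simp only [AddMonoidHom.sub_apply, AddMonoidHom.finsetSum_apply, AddMonoidHom.coe_mulLeft,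
        AddMonoidHom.id_apply]
  · let γh : A →+ A := (γ g : A →⋆ₙₐ[ℂ] A).toNonUnitalAlgHom.toDistribMulActionHom.toAddMonoidHom
    refine hdensity (fun n => γh.comp (AddMonoidHom.mulLeft (P n m)) -
      (AddMonoidHom.mulLeft (P n (m * g⁻¹))).comp γh) 2
      -- With D = 2|G| + 1, replacing γ_g by stage n + 1 costs D/2^n at P_m d_k and again at d_k;
      -- the equivariance error of that stage is 1/2^n.
      (1 + 2 * (2 * Fintype.card G + 1)) (fun n a => ?_) fun k n hkn => ?_
    · refine (norm_sub_le _ _).trans ?_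
      have h1 : ‖γ g (P n m * a)‖ ≤ ‖a‖ := by
        rw [StarAlgEquiv.norm_map]
        exact hle _ _ _
      have h2 : ‖P n (m * g⁻¹) * γ g a‖ ≤ ‖a‖ := (hle _ _ _).trans_eq (StarAlgEquiv.norm_map _ _)
      change ‖γ g (P n m * a)‖ + ‖P n (m * g⁻¹) * γ g a‖ ≤ _
      linarith
    · have h1 := hγb (n + 1) _ ((htow k n hkn).1 m) g
      have h2 := hγb (n + 1) (d k) (hFset n (st n) (hFd k n hkn)) g
      have h3 := (htow k n hkn).2.1 g m
      change ‖γ g (P n m * d k) - P n (m * g⁻¹) * γ g (d k)‖ ≤ _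
      have h4 := hle n (m * g⁻¹) (γ g (d k) - b (n + 1) g (d k))
      have h5 : γ g (P n m * d k) - P n (m * g⁻¹) * γ g (d k) =
          (γ g (P n m * d k) - b (n + 1) g (P n m * d k)) +
          (b (n + 1) g (P n m * d k) - P n (m * g⁻¹) * b (n + 1) g (d k)) -
          P n (m * g⁻¹) * (γ g (d k) - b (n + 1) g (d k)) := by
        rw [mul_sub]
        abel
      rw [h5]
      refine (norm_sub_le _ _).trans ((add_le_add_left (norm_add_le _ _) _).trans ?_)
      refine (add_le_add (add_le_add h1 h3) (h4.trans h2)).trans_eq ?_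
      rw [pow_succ]
      field_simp
      ring
  -- Since Ad(u_n)β_g tends to γ_g pointwise and Ad(u_n*) is isometric, Ad(u_n*)γ_g tends to β_g.
  · refine tendsto_iff_norm_sub_tendsto_zero.2
      ((tendsto_iff_norm_sub_tendsto_zero.1 (hγlim g a)).congr fun n => ?_)
    have h1 : conjAut (star ((st n).unitaries g)) (b n g a) = β g a := by
      change (conjAut (star ((st n).unitaries g)) * conjAut ((st n).unitaries g)) (β g a) = _
      rw [← conjAut_mul, Unitary.star_mul_self, conjAut_one]
      rfl
    change _ = ‖_ - ((β g a : A) : Unitization ℂ A)‖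
    rw [norm_sub_rev, ← h1]
    change _ = ‖(star ((st n).unitaries g) : unitary (Unitization ℂ A)) *
      ((γ g a : A) : Unitization ℂ A) * star ((star ((st n).unitaries g) :
        unitary (Unitization ℂ A)) : Unitization ℂ A) - _‖
    rw [← inr_conjAut, ← Unitization.inr_sub, Unitization.norm_inr, ← map_sub,
      StarAlgEquiv.norm_map]

end Iteration

end RokhlinLift

end

theorem theorem2p3 {G : Type*} [Group G] [Finite G]
    {A : Type*} [NonUnitalCStarAlgebra A] [TopologicalSpace.SeparableSpace A]
    (hUHF : TensorAbsorbs (UHF (Nat.card G)) A)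
    (hA : HasUnit A ∨ IsStable A ∨ HasStableRankOne A)
    (β : G → (A ≃⋆ₐ[ℂ] A))
    (hβ : ∀ g h : G, ApproxUnitarilyEquiv
      ((β g * β h : A ≃⋆ₐ[ℂ] A) : A →⋆ₙₐ[ℂ] A) (β (g * h) : A →⋆ₙₐ[ℂ] A)) :
    ∃ γ : G →* (A ≃⋆ₐ[ℂ] A), HasRokhlinProperty γ ∧
      ∀ g : G, ApproxUnitarilyEquiv (γ g : A →⋆ₙₐ[ℂ] A) (β g : A →⋆ₙₐ[ℂ] A) := by
  classical
  have := Fintype.ofFinite G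
  obtain ⟨T, l, e, hl, he⟩ := exists_centralMatrixUnits hUHF (Finite.equivFin G)
  exact exists_rokhlin_action he hβ
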